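/- Let $k\in\mathbb{N}$. An $\mathcal{L}'(k)$-tree is a rooted strict binary tree (every vertex is a leaf or has exactly two children; a single vertex is allowed) in which, at every internal vertex, the two edges leading to its children are assigned positive integer lengths whose sum is $k$. The depth of a leaf is the total length of the edges on the path from the root to it. A leaf signature is a multiset $D=\{d_1,\dots,d_n\}$ of $n\ge 1$ non-negative integers; it is realizable (for $k$) if there is an $\mathcal{L}'(k)$-tree with exactly $n$ leaves that can be numbered $v_1,\dots,v_n$ such that the depth of $v_i$ is at most $d_i$ for all $i$. There is an algorithm that, given $k\in\mathbb{N}$ and a leaf signature $D=\{d_1,\dots,d_n\}$ (as a list in arbitrary order), decides whether $D$ is realizable for $k$ and, if it is, constructs an $\mathcal{L}'(k)$-tree with $n$ leaves at depths at most $d_1,\dots,d_n$; for every fixed $k$ its running time is $O(n^{k+3})$, where the constant depends only on $k$. Here running time is the number of steps on a random access machine on natural numbers with unit-cost addition, truncated subtraction, zero test, and indirect memory access. -/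

import Mathlib

/-- Rooted strict binary trees with edge lengths: a single leaf, or a root with exactly two
children, where `a` and `b` are the lengths of the edges to the roots of `l` and `r`. -/
inductive LTree where
  | leaf : LTree
  | node (a b : ℕ) (l r : LTree) : LTree

namespace LTree

/-- `T.IsL k`: at every internal node the two child edges have positive lengths with sum `k`. -/
def IsL (k : ℕ) : LTree → Prop
  | leaf => True
  | node a b l r => 1 ≤ a ∧ 1 ≤ b ∧ a + b = k ∧ l.IsL k ∧ r.IsL k

/-- The multiset of the depths of the leaves, with respect to the edge lengths. -/
def leafDepths : LTree → Multiset ℕ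
  | leaf => {0}
  | node a b l r => l.leafDepths.map (a + ·) + r.leafDepths.map (b + ·)

/-- The leaves can be matched bijectively with the elements of `D` so that the depth of every leaf
is at most the element matched with it. -/
def Meets (T : LTree) (D : Multiset ℕ) : Prop :=
  Multiset.Rel (· ≤ ·) T.leafDepths D

end LTree

/-- The leaf signature `D` is realizable for the parameter `k`. -/
def Realizable (k : ℕ) (D : Multiset ℕ) : Prop :=
  ∃ T : LTree, T.IsL k ∧ T.Meets D

namespace RAM

/-- A configuration of the random access machine: registers and memory, holding natural numbers.
A program mentions only finitely many registers. -/
structure State where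
  reg : ℕ → ℕ
  mem : ℕ → ℕ

namespace State

/-- Write `v` to register `x`. -/
def setReg (s : State) (x v : ℕ) : State :=
  { s with reg := Function.update s.reg x v }

/-- Write `v` to the memory cell with address `p`. -/
def setMem (s : State) (p v : ℕ) : State :=
  { s with mem := Function.update s.mem p v }

end State

/-- Programs of the random access machine. Its arithmetic is addition and truncated subtraction
only; memory is accessed by indirect addressing. -/
inductive Prog where
  | skip : Prog
  /-- `x := c` -/
  | const (x c : ℕ) : Prog
  /-- `x := y` -/
  | copy (x y : ℕ) : Prog
  /-- `x := y + z` -/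
  | add (x y z : ℕ) : Prog
  /-- `x := y - z`, truncated at zero -/
  | sub (x y z : ℕ) : Prog
  /-- `x := mem[y]` -/
  | load (x y : ℕ) : Prog
  /-- `mem[x] := y` -/
  | store (x y : ℕ) : Prog
  | seq (P Q : Prog) : Prog
  /-- run `P` if register `x` is nonzero, and `Q` otherwise -/
  | branch (x : ℕ) (P Q : Prog) : Prog
  /-- run `P` as long as register `x` is nonzero -/
  | loop (x : ℕ) (P : Prog) : Prog

/-- `Exec P s t s'`: the program `P`, started in `s`, halts in `s'` after exactly `t` steps. Every
elementary instruction and every evaluation of the test of a branch or of a loop is one step. -/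
inductive Exec : Prog → State → ℕ → State → Prop where
  | skip (s : State) : Exec .skip s 1 s
  | const (s : State) (x c : ℕ) : Exec (.const x c) s 1 (s.setReg x c)
  | copy (s : State) (x y : ℕ) : Exec (.copy x y) s 1 (s.setReg x (s.reg y))
  | add (s : State) (x y z : ℕ) : Exec (.add x y z) s 1 (s.setReg x (s.reg y + s.reg z))
  | sub (s : State) (x y z : ℕ) : Exec (.sub x y z) s 1 (s.setReg x (s.reg y - s.reg z))
  | load (s : State) (x y : ℕ) : Exec (.load x y) s 1 (s.setReg x (s.mem (s.reg y)))
  | store (s : State) (x y : ℕ) : Exec (.store x y) s 1 (s.setMem (s.reg x) (s.reg y))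
  | seq {P Q : Prog} {s s₁ s₂ : State} {t₁ t₂ : ℕ} (hP : Exec P s t₁ s₁) (hQ : Exec Q s₁ t₂ s₂) :
      Exec (.seq P Q) s (t₁ + t₂) s₂
  | branch_ne {x : ℕ} {P Q : Prog} {s s₁ : State} {t : ℕ} (hx : s.reg x ≠ 0) (hP : Exec P s t s₁) :
      Exec (.branch x P Q) s (1 + t) s₁
  | branch_eq {x : ℕ} {P Q : Prog} {s s₁ : State} {t : ℕ} (hx : s.reg x = 0) (hQ : Exec Q s t s₁) :
      Exec (.branch x P Q) s (1 + t) s₁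
  | loop_ne {x : ℕ} {P : Prog} {s s₁ s₂ : State} {t₁ t₂ : ℕ} (hx : s.reg x ≠ 0)
      (hP : Exec P s t₁ s₁) (hL : Exec (.loop x P) s₁ t₂ s₂) :
      Exec (.loop x P) s (1 + t₁ + t₂) s₂
  | loop_eq {x : ℕ} {P : Prog} {s : State} (hx : s.reg x = 0) : Exec (.loop x P) s 1 s

/-- The initial configuration for the parameter `k` and the signature `d₁, …, dₙ`, listed in any
order: register 0 holds `n`, register 1 holds `k`, the memory cells `0, …, n - 1` hold
`d₁, …, dₙ`, and everything else is zero. -/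
def input (k : ℕ) (d : List ℕ) : State where
  reg x := if x = 0 then d.length else if x = 1 then k else 0
  mem p := d.getD p 0

/-- `Stored m T p S`: the tree `T` is stored in the memory `m` as a linked structure with root
record at address `p`, the records occupying exactly the cells in `S` and not overlapping. A leaf
is a cell with content 0. An internal node consists of four consecutive cells with the lengths of
its two child edges, the first of which is nonzero, and the addresses of its two children. -/
inductive Stored (m : ℕ → ℕ) : LTree → ℕ → Finset ℕ → Prop where
  | leaf {p : ℕ} (hp : m p = 0) : Stored m .leaf p {p}
  | node {p : ℕ} {l r : LTree} {S₁ S₂ : Finset ℕ} (hp : m p ≠ 0)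
      (hl : Stored m l (m (p + 2)) S₁) (hr : Stored m r (m (p + 3)) S₂)
      (h₁₂ : Disjoint S₁ S₂) (h₁ : Disjoint {p, p + 1, p + 2, p + 3} S₁)
      (h₂ : Disjoint {p, p + 1, p + 2, p + 3} S₂) :
      Stored m (.node (m p) (m (p + 1)) l r) p ({p, p + 1, p + 2, p + 3} ∪ S₁ ∪ S₂)

end RAM

/-! Put `K = k - 1`. A tree can be grown level by level, remembering only the current level `l`, the
number of finished leaves and the multiset of levels of pending nodes. A pending node at level `l`
either becomes a leaf or splits into children at levels `l + a` and `l + (K + 1 - a)`; once no node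
is pending at `l`, the level rises. Pending levels stay in the window from `l` to `l + K`, finished
and pending nodes together number at most `n`, and levels up to `K * n` suffice, so for fixed `k`
there are only polynomially many configurations.

Depths `X` can be matched below `D` as soon as the cardinalities agree and, for every threshold, `X`
has at least as many elements below it as `D` (`Multiset.rel_le_of_countP_lt_le`). During the growth
this needs a test only when a leaf is finished at level `l`: at most as many entries of `D` lie
below `l` as there are leaves finished before. Thus `D` is realizable exactly if a configuration
with `n` finished leaves is reachable. One direction follows a given tree
(`Conf.exists_reachable_of_realizable`); the other reads a path backwards and assembles a forest
(`Conf.Completes`).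

The machine decides reachability with a table. The address of a configuration is a mixed-radix
number made of the remaining levels, the unfinished leaves and a code of the pending multiset. Every
step strictly lowers it (`Conf.Step.addr_lt`), so one sweep from high to low addresses meets each
configuration after all its predecessors. A record keeps a predecessor and the kind of the step,
hence a final record carries a path back to the start (`Conf.Chain`). Undoing that path with one
linked list of trees per level (`Holds`) produces the tree in memory.

The table has `(n + 2) ^ (K + 1) * (n + 1) * (K * n + 1)` records, each handled in time linear in
`n` for fixed `k`. For `k ≥ 1` this gives the exponent `K + 4 = k + 3`; for `k = 0` the factor for
the levels is `1`. -/

namespace RAM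

/-! ### Execution of programs: framing, time-bounded triples, multiplication -/

namespace State

theorem reg_setReg (s : State) (x v y : ℕ) :
    (s.setReg x v).reg y = if y = x then v else s.reg y := by
  simp [setReg, Function.update_apply]

theorem mem_setReg (s : State) (x v : ℕ) : (s.setReg x v).mem = s.mem := rfl

theorem reg_setMem (s : State) (p v : ℕ) : (s.setMem p v).reg = s.reg := rfl

theorem mem_setMem (s : State) (p v : ℕ) : (s.setMem p v).mem = Function.update s.mem p v := rfl

end State

namespace Prog

/-- Sequential composition of a list of programs. -/
def block : List Prog → Prog
  | [] => skip
  | P :: l => seq P (block l)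

/-- The program contains no loop. -/
def loopFree : Prog → Bool
  | seq P Q => P.loopFree && Q.loopFree
  | branch _ P Q => P.loopFree && Q.loopFree
  | loop _ _ => false
  | _ => true

/-- The result of running a loop-free program. -/
def run : Prog → State → State
  | skip, s => s
  | const x c, s => s.setReg x c
  | copy x y, s => s.setReg x (s.reg y)
  | add x y z, s => s.setReg x (s.reg y + s.reg z)
  | sub x y z, s => s.setReg x (s.reg y - s.reg z)
  | load x y, s => s.setReg x (s.mem (s.reg y))
  | store x y, s => s.setMem (s.reg x) (s.reg y)
  | seq P Q, s => Q.run (P.run s)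
  | branch x P Q, s => if s.reg x = 0 then Q.run s else P.run s
  | loop _ _, s => s

/-- An upper bound for the number of steps of a loop-free program. -/
def cost : Prog → ℕ
  | seq P Q => P.cost + Q.cost
  | branch _ P Q => 1 + max P.cost Q.cost
  | _ => 1

/-- All registers the program writes to have index at least `b`. -/
def writesGE (b : ℕ) : Prog → Bool
  | skip => true
  | const x _ => decide (b ≤ x)
  | copy x _ => decide (b ≤ x)
  | add x _ _ => decide (b ≤ x)
  | sub x _ _ => decide (b ≤ x)
  | load x _ => decide (b ≤ x)
  | store _ _ => true
  | seq P Q => P.writesGE b && Q.writesGE b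
  | branch _ P Q => P.writesGE b && Q.writesGE b
  | loop _ P => P.writesGE b

/-- The program does not write to register `r`. -/
def keeps (r : ℕ) : Prog → Bool
  | skip => true
  | const x _ => decide (r ≠ x)
  | copy x _ => decide (r ≠ x)
  | add x _ _ => decide (r ≠ x)
  | sub x _ _ => decide (r ≠ x)
  | load x _ => decide (r ≠ x)
  | store _ _ => true
  | seq P Q => P.keeps r && Q.keeps r
  | branch _ P Q => P.keeps r && Q.keeps r
  | loop _ P => P.keeps r

/-- The program does not write to the memory. -/
def storeFree : Prog → Bool
  | store _ _ => false
  | seq P Q => P.storeFree && Q.storeFree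
  | branch _ P Q => P.storeFree && Q.storeFree
  | loop _ P => P.storeFree
  | _ => true

theorem keeps_of_writesGE {b r : ℕ} (hr : r < b) :
    ∀ {P : Prog}, P.writesGE b = true → P.keeps r = true := by
  intro P
  induction P with
  | skip => simp [keeps]
  | store => simp [keeps]
  | seq P Q hP hQ => simp only [writesGE, keeps, Bool.and_eq_true]; exact fun h => ⟨hP h.1, hQ h.2⟩
  | branch x P Q hP hQ =>
    simp only [writesGE, keeps, Bool.and_eq_true]; exact fun h => ⟨hP h.1, hQ h.2⟩
  | loop x P hP => simpa [writesGE, keeps] using hP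
  | _ => simp only [writesGE, keeps, decide_eq_true_eq]; omega

end Prog

theorem Exec.reg_eq {P : Prog} {s s' : State} {t : ℕ} (h : Exec P s t s') {r : ℕ}
    (hr : P.keeps r = true) : s'.reg r = s.reg r := by
  induction h with
  | seq _ _ h₁ h₂ =>
    simp only [Prog.keeps, Bool.and_eq_true] at hr
    rw [h₂ hr.2, h₁ hr.1]
  | branch_ne _ _ h => simp only [Prog.keeps, Bool.and_eq_true] at hr; exact h hr.1
  | branch_eq _ _ h => simp only [Prog.keeps, Bool.and_eq_true] at hr; exact h hr.2
  | loop_ne _ _ _ h₁ h₂ => rw [h₂ hr, h₁ (by simpa [Prog.keeps] using hr)]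
  | skip => rfl
  | loop_eq => rfl
  | store => rfl
  | _ =>
    simp only [Prog.keeps, decide_eq_true_eq] at hr
    rw [State.reg_setReg, if_neg hr]

theorem Exec.mem_eq {P : Prog} {s s' : State} {t : ℕ} (h : Exec P s t s')
    (hP : P.storeFree = true) : s'.mem = s.mem := by
  induction h with
  | seq _ _ h₁ h₂ =>
    simp only [Prog.storeFree, Bool.and_eq_true] at hP
    rw [h₂ hP.2, h₁ hP.1]
  | branch_ne _ _ h => simp only [Prog.storeFree, Bool.and_eq_true] at hP; exact h hP.1
  | branch_eq _ _ h => simp only [Prog.storeFree, Bool.and_eq_true] at hP; exact h hP.2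
  | loop_ne _ _ _ h₁ h₂ => rw [h₂ hP, h₁ (by simpa [Prog.storeFree] using hP)]
  | store => simp [Prog.storeFree] at hP
  | _ => rfl

/-- Total correctness with a time bound: started in `s`, the program `P` halts after at most `T`
steps in a state that satisfies `Q`. -/
def Tri (P : Prog) (s : State) (T : ℕ) (Q : State → Prop) : Prop :=
  ∃ t s', Exec P s t s' ∧ t ≤ T ∧ Q s'

namespace Tri

variable {P P' : Prog} {s : State} {T T' : ℕ} {Q R : State → Prop}

theorem mono (h : Tri P s T Q) (hT : T ≤ T') (hQ : ∀ s', Q s' → R s') : Tri P s T' R := by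
  obtain ⟨t, s', h₁, h₂, h₃⟩ := h
  exact ⟨t, s', h₁, h₂.trans hT, hQ _ h₃⟩

theorem seq (h : Tri P s T Q) (h' : ∀ s', Q s' → Tri P' s' T' R) :
    Tri (.seq P P') s (T + T') R := by
  obtain ⟨t, s', h₁, h₂, h₃⟩ := h
  obtain ⟨t', s'', h₁', h₂', h₃'⟩ := h' s' h₃
  exact ⟨_, _, h₁.seq h₁', add_le_add h₂ h₂', h₃'⟩

theorem branch {x : ℕ} (h : s.reg x ≠ 0 → Tri P s T Q) (h' : s.reg x = 0 → Tri P' s T Q) :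
    Tri (.branch x P P') s (1 + T) Q := by
  by_cases hx : s.reg x = 0
  · obtain ⟨t, s', h₁, h₂, h₃⟩ := h' hx
    exact ⟨_, _, .branch_eq hx h₁, by omega, h₃⟩
  · obtain ⟨t, s', h₁, h₂, h₃⟩ := h hx
    exact ⟨_, _, .branch_ne hx h₁, by omega, h₃⟩

/-- The index of the invariant is the exact number of passes still to come, so termination and the
time bound come from the same induction. -/
theorem loop {x : ℕ} {I : ℕ → State → Prop} (h₀ : ∀ s, I 0 s → s.reg x = 0)
    (hs : ∀ j s, I (j + 1) s → s.reg x ≠ 0 ∧ Tri P s T (I j)) :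
    ∀ j s, I j s → Tri (.loop x P) s (j * (T + 1) + 1) (I 0) := by
  intro j
  induction j with
  | zero => exact fun s h => ⟨1, s, .loop_eq (h₀ s h), by simp, h⟩
  | succ j ih =>
    intro s h
    obtain ⟨hx, t, s', h₁, h₂, h₃⟩ := hs j s h
    obtain ⟨t', s'', h₁', h₂', h₃'⟩ := ih s' h₃
    refine ⟨_, _, .loop_ne hx h₁ h₁', ?_, h₃'⟩
    rw [Nat.succ_mul]
    omega

/-- Straight-line code with branches always halts, so its correctness reduces to evaluating
`Prog.run`, a computation for `simp`. -/
theorem of_loopFree (hP : P.loopFree = true) (h : Q (P.run s)) : Tri P s P.cost Q := by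
  suffices ∀ P : Prog, P.loopFree = true → ∀ s, ∃ t ≤ P.cost, Exec P s t (P.run s) by
    obtain ⟨t, h₁, h₂⟩ := this P hP s
    exact ⟨t, _, h₂, h₁, h⟩
  intro P
  induction P with
  | seq P Q hP hQ =>
    intro h s
    simp only [Prog.loopFree, Bool.and_eq_true] at h
    obtain ⟨t, h₁, h₂⟩ := hP h.1 s
    obtain ⟨t', h₁', h₂'⟩ := hQ h.2 (P.run s)
    exact ⟨_, add_le_add h₁ h₁', h₂.seq h₂'⟩
  | branch x P Q hP hQ =>
    intro h s
    simp only [Prog.loopFree, Bool.and_eq_true] at h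
    obtain ⟨t, h₁, h₂⟩ := hP h.1 s
    obtain ⟨t', h₁', h₂'⟩ := hQ h.2 s
    by_cases hx : s.reg x = 0
    · exact ⟨1 + t', by simp only [Prog.cost]; omega, by simpa [Prog.run, hx] using .branch_eq hx h₂'⟩
    · exact ⟨1 + t, by simp only [Prog.cost]; omega, by simpa [Prog.run, hx] using .branch_ne hx h₂⟩
  | loop => simp [Prog.loopFree]
  | _ => exact fun _ s => ⟨1, le_rfl, by constructor⟩

/-- Registers the program does not write to keep their values. -/
theorem frame (h : Tri P s T Q) :
    Tri P s T fun s' => Q s' ∧ ∀ r, P.keeps r = true → s'.reg r = s.reg r := by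
  obtain ⟨t, s', h₁, h₂, h₃⟩ := h
  exact ⟨t, s', h₁, h₂, h₃, fun r hr => h₁.reg_eq hr⟩

theorem frame_mem (h : Tri P s T Q) (hP : P.storeFree = true) :
    Tri P s T fun s' => Q s' ∧ s'.mem = s.mem := by
  obtain ⟨t, s', h₁, h₂, h₃⟩ := h
  exact ⟨t, s', h₁, h₂, h₃, h₁.mem_eq hP⟩

end Tri

/-- `x := y * z` by repeated addition, with the counter `w`; register 2 has to hold `1`. -/
def Prog.mul (x y z w : ℕ) : Prog :=
  .seq (.seq (.const x 0) (.copy w z)) (.loop w (.seq (.add x x y) (.sub w w 2)))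

/-- The time depends on the factor in `z` only. All uses put a factor linear in `n` there, so even
the table dimensions are cheap to compute. -/
theorem Tri.mul {s : State} (x y z w : ℕ) (h₂ : s.reg 2 = 1) (hxy : x ≠ y) (hxz : x ≠ z)
    (hxw : x ≠ w) (hyw : y ≠ w) (hw : w ≠ 2) (hx : x ≠ 2) :
    Tri (Prog.mul x y z w) s (3 * s.reg z + 3) fun s' =>
      s'.reg x = s.reg y * s.reg z ∧ s'.mem = s.mem ∧
        ∀ r, r ≠ x → r ≠ w → s'.reg r = s.reg r := by
  have key : Tri (Prog.mul x y z w) s (3 * s.reg z + 3) fun s' =>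
      s'.reg x = s.reg y * s.reg z := by
    refine Tri.mono (T := 2 + (s.reg z * (2 + 1) + 1)) (Q := fun s' => s'.reg x = s.reg y * s.reg z)
      ?_ (by omega) (fun _ h => h)
    refine Tri.seq (Q := fun s' => s'.reg x = 0 ∧ s'.reg w = s.reg z ∧ s'.reg y = s.reg y ∧
      s'.reg 2 = 1) (Tri.of_loopFree rfl ?_) ?_
    · simp [Prog.run, State.reg_setReg, hxz.symm, hxw, hyw, hxy.symm, hw.symm, hx.symm, h₂]
    intro s₁ hs₁
    refine Tri.mono (Tri.loop (I := fun j s' => ∃ e, e + j = s.reg z ∧ s'.reg x = s.reg y * e ∧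
      s'.reg w = j ∧ s'.reg y = s.reg y ∧ s'.reg 2 = 1) ?_ ?_ (s.reg z) s₁ ?_) le_rfl ?_
    · rintro s' ⟨e, -, -, h, -⟩
      exact h
    · rintro j s' ⟨e, he, h₁, h₃, h₄, h₅⟩
      refine ⟨by omega, Tri.of_loopFree rfl ⟨e + 1, by omega, ?_⟩⟩
      simp [Prog.run, State.reg_setReg, hxw, hyw, hxy.symm, hw.symm, hx.symm, h₁, h₃, h₄, h₅,
        mul_add, hxw.symm]
    · exact ⟨0, by omega, by simpa using hs₁⟩
    · rintro s' ⟨e, he, h₁, -⟩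
      rw [h₁, ← he, add_zero]
  refine (key.frame.frame_mem rfl).mono le_rfl ?_
  rintro s' ⟨⟨h₁, h₃⟩, h₄⟩
  exact ⟨h₁, h₄, fun r hr hr' => h₃ r (by simp [Prog.mul, Prog.keeps, hr, hr'])⟩

end RAM

/-! ### Configurations and the steps between them -/

/-- A configuration of the level-by-level construction of a tree: the current level, the number of
leaves that are finished, and the levels of the pending nodes. -/
@[ext]
structure Conf where
  lev : ℕ
  done : ℕ
  pend : Multiset ℕ

namespace Conf

/-- The start configuration: the root is pending at level `0`. -/
def start : Conf := ⟨0, 0, {0}⟩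

/-- The steps of the level-by-level construction of trees with `n` leaves that meet `D`, where
`K + 1` is the sum of the lengths of sibling edges. The first argument is a code for the kind of the
step. -/
inductive Step (n K : ℕ) (D : Multiset ℕ) : ℕ → Conf → Conf → Prop where
  | shift {l i : ℕ} {M : Multiset ℕ} (hM : l ∉ M) (hi : i < n) (hl : l < K * n) :
      Step n K D 0 ⟨l, i, M⟩ ⟨l + 1, i, M⟩
  | leaf {l i : ℕ} {M : Multiset ℕ} (hD : D.countP (· < l) ≤ i) :
      Step n K D (K + 1) ⟨l, i, l ::ₘ M⟩ ⟨l, i + 1, M⟩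
  | split {a l i : ℕ} {M : Multiset ℕ} (ha : 1 ≤ a) (haK : a ≤ K) (hn : i + M.card + 1 < n) :
      Step n K D a ⟨l, i, l ::ₘ M⟩ ⟨l, i, (l + a) ::ₘ (l + (K + 1 - a)) ::ₘ M⟩

/-- The constraints that are satisfied by all reachable configurations. -/
structure Valid (n K : ℕ) (s : Conf) : Prop where
  lev_le : s.lev ≤ K * n
  le_pend : ∀ x ∈ s.pend, s.lev ≤ x
  pend_le : ∀ x ∈ s.pend, x ≤ s.lev + K
  card_le : s.done + s.pend.card ≤ n
  card_pos : 1 ≤ s.done + s.pend.card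

variable {n K mv : ℕ} {D : Multiset ℕ} {s s' : Conf}

theorem valid_start (hn : 1 ≤ n) : start.Valid n K := by
  constructor <;> simp [start, hn]

/-- The window of width `K` survives because the level rises only when nothing is pending at its
lower end, and because both edges of a split have length at most `K`. -/
theorem Step.valid (h : Step n K D mv s s') (hs : s.Valid n K) : s'.Valid n K := by
  obtain ⟨h₁, h₂, h₃, h₄, h₅⟩ := hs
  cases h with
  | @shift l i M hM hi hl =>
    refine ⟨hl, fun x hx => ?_, fun x hx => ?_, h₄, h₅⟩
    · have := h₂ x hx
      have : l ≠ x := fun h => hM (h ▸ hx)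
      simp only at *
      omega
    · have := h₃ x hx
      simp only at *
      omega
  | @leaf l i M hD =>
    refine ⟨h₁, fun x hx => h₂ x (Multiset.mem_cons_of_mem hx),
      fun x hx => h₃ x (Multiset.mem_cons_of_mem hx), ?_, ?_⟩ <;>
    · simp only [Multiset.card_cons] at *
      omega
  | @split a l i M ha haK hn =>
    refine ⟨h₁, fun x hx => ?_, fun x hx => ?_, ?_, ?_⟩
    · simp only [Multiset.mem_cons] at hx h₂ ⊢
      rcases hx with rfl | rfl | hx
      · omega
      · omega
      · exact h₂ x (Or.inr hx)
    · simp only [Multiset.mem_cons] at hx h₃ ⊢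
      rcases hx with rfl | rfl | hx
      · omega
      · omega
      · exact h₃ x (Or.inr hx)
    · simp only [Multiset.card_cons]; omega
    · simp only [Multiset.card_cons]; omega

end Conf

/-! ### Leaves of forests and the counting criterion for matching -/

namespace LTree

/-- The number of vertices. -/
def size : LTree → ℕ
  | leaf => 1
  | node _ _ l r => l.size + r.size + 1

theorem one_le_card_leafDepths (T : LTree) : 1 ≤ T.leafDepths.card := by
  induction T with
  | leaf => simp [leafDepths]
  | node a b l r hl hr => simp only [leafDepths, Multiset.card_add, Multiset.card_map]; omega

/-- The depths of the leaves of a forest; every tree comes with the level of its root. -/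
def leaves (F : Multiset (ℕ × LTree)) : Multiset ℕ :=
  F.bind fun x => x.2.leafDepths.map (x.1 + ·)

@[simp]
theorem leaves_zero : leaves 0 = 0 := Multiset.zero_bind _

@[simp]
theorem leaves_cons (l : ℕ) (T : LTree) (F : Multiset (ℕ × LTree)) :
    leaves ((l, T) ::ₘ F) = T.leafDepths.map (l + ·) + leaves F := Multiset.cons_bind _ _ _

theorem leaves_cons_leaf (l : ℕ) (F : Multiset (ℕ × LTree)) :
    leaves ((l, leaf) ::ₘ F) = l ::ₘ leaves F := by
  simp [leafDepths]

theorem card_le_card_leaves (F : Multiset (ℕ × LTree)) : F.card ≤ (leaves F).card := by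
  induction F using Multiset.induction with
  | empty => simp
  | cons x F ih =>
    obtain ⟨l, T⟩ := x
    have := T.one_le_card_leafDepths
    simp only [leaves_cons, Multiset.card_add, Multiset.card_map, Multiset.card_cons]
    omega

theorem le_of_mem_leaves {F : Multiset (ℕ × LTree)} {l x : ℕ} (hF : ∀ y ∈ F, l ≤ y.1)
    (hx : x ∈ leaves F) : l ≤ x := by
  simp only [leaves, Multiset.mem_bind, Multiset.mem_map] at hx
  obtain ⟨y, hy, z, -, rfl⟩ := hx
  exact (hF y hy).trans (Nat.le_add_right _ _)

theorem leaves_split (l a b : ℕ) (T T' : LTree) (F : Multiset (ℕ × LTree)) :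
    leaves ((l, node a b T T') ::ₘ F) = leaves ((l + a, T) ::ₘ (l + b, T') ::ₘ F) := by
  simp [leafDepths, Multiset.map_map, add_assoc]

end LTree

theorem Multiset.Rel.countP_lt_le {X D : Multiset ℕ} (h : Multiset.Rel (· ≤ ·) X D) (l : ℕ) :
    D.countP (· < l) ≤ X.countP (· < l) := by
  induction h with
  | zero => simp
  | @cons a b as bs hab _ ih =>
    simp only [Multiset.countP_cons]
    split_ifs <;> omega

/-- The smallest elements of `X` and `D` can be matched with each other. Removing them preserves the
counting condition: up to the minimum of `D` nothing is demanded, and above it both counts drop by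
one. -/
theorem Multiset.rel_le_of_countP_lt_le (D : Multiset ℕ) :
    ∀ {X : Multiset ℕ}, X.card = D.card →
      (∀ l, D.countP (· < l) ≤ X.countP (· < l)) → Multiset.Rel (· ≤ ·) X D := by
  induction h : D.card generalizing D with
  | zero =>
    intro X hX _
    rw [Multiset.card_eq_zero] at h hX
    subst h hX
    exact .zero
  | succ m ih =>
    intro X hX hc
    have hD0 : ∃ b ∈ D, ∀ y ∈ D, b ≤ y := by
      have : D.toFinset.Nonempty := by
        rw [Multiset.toFinset_nonempty]; rintro rfl; simp at h
      exact ⟨D.toFinset.min' this, by simpa using D.toFinset.min'_mem this,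
        fun y hy => Finset.min'_le _ _ (by simpa using hy)⟩
    have hX0 : ∃ a ∈ X, ∀ y ∈ X, a ≤ y := by
      have : X.toFinset.Nonempty := by
        rw [Multiset.toFinset_nonempty]; rintro rfl; simp at hX
      exact ⟨X.toFinset.min' this, by simpa using X.toFinset.min'_mem this,
        fun y hy => Finset.min'_le _ _ (by simpa using hy)⟩
    obtain ⟨b, hb, hbm⟩ := hD0
    obtain ⟨a, ha, ham⟩ := hX0
    obtain ⟨D', rfl⟩ := Multiset.exists_cons_of_mem hb
    obtain ⟨X', rfl⟩ := Multiset.exists_cons_of_mem ha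
    -- At the threshold `b + 1` the count for `D` is positive, so `X` has an element that is at most
    -- `b`.
    have hab : a ≤ b := by
      have h1 := hc (b + 1)
      have h2 : 0 < Multiset.countP (· < b + 1) (a ::ₘ X') := by
        refine lt_of_lt_of_le ?_ h1
        rw [Multiset.countP_pos]; exact ⟨b, hb, by omega⟩
      obtain ⟨y, hy, hy'⟩ := Multiset.countP_pos.1 h2
      have := ham y hy
      omega
    refine .cons hab (ih D' (by simpa using h) (by simpa using hX) fun l => ?_)
    have h1 := hc l
    simp only [Multiset.countP_cons] at h1
    by_cases hl : l ≤ b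
    · have : Multiset.countP (· < l) D' = 0 := by
        rw [Multiset.countP_eq_zero]
        intro y hy
        have := hbm y (Multiset.mem_cons_of_mem hy)
        omega
      omega
    · rw [if_pos (by omega), if_pos (by omega)] at h1
      omega

/-! ### Realizability as reachability of a configuration -/

namespace Conf

open LTree

variable {n k : ℕ} {D : Multiset ℕ}

/-- The trees hanging at the pending nodes dictate the steps; `w` bounds the vertices left plus the
levels left. The bound on root levels persists because a split adds at most `k - 1` to a level and
exactly one to the number of finished and pending nodes. -/
theorem exists_reachable_done {k n : ℕ} {D : Multiset ℕ} (w : ℕ) :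
    ∀ (l i : ℕ) (F : Multiset (ℕ × LTree)),
      (F.map fun x => x.2.size).sum + ((k - 1) * n - l) ≤ w →
      (∀ x ∈ F, x.2.IsL k) → (∀ x ∈ F, l ≤ x.1) →
      (∀ x ∈ F, x.1 + (k - 1) ≤ (k - 1) * (i + F.card)) →
      i + (leaves F).card = n → (∀ x, D.countP (· < x) ≤ i + (leaves F).countP (· < x)) →
      ∃ s, Relation.ReflTransGen (fun s s' => ∃ mv, Step n (k - 1) D mv s s')
        ⟨l, i, F.map Prod.fst⟩ s ∧ s.done = n := by
  induction w with
  | zero =>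
    intro l i F hw _ _ _ hn _
    refine ⟨_, .refl, ?_⟩
    have : F = 0 := by
      rcases F.empty_or_exists_mem with h | ⟨⟨l', T⟩, h⟩
      · exact h
      · obtain ⟨F, rfl⟩ := Multiset.exists_cons_of_mem h
        cases T <;> simp [size] at hw
    subst this
    simpa using hn
  | succ w ih =>
    intro l i F hw hL hl hK hn hD
    by_cases hF : l ∈ F.map Prod.fst
    · obtain ⟨⟨l', T⟩, hx, rfl⟩ := Multiset.mem_map.1 hF
      obtain ⟨F, rfl⟩ := Multiset.exists_cons_of_mem hx
      simp only [Multiset.mem_cons, forall_eq_or_imp, Multiset.map_cons, Multiset.sum_cons,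
        Multiset.card_cons] at hL hl hK hw
      cases T with
      | leaf =>
        have h0 := hD l'
        -- No remaining leaf lies below the current level, so the counting condition at this level
        -- is exactly the guard of the leaf step.
        have hz : (leaves ((l', leaf) ::ₘ F)).countP (· < l') = 0 :=
          Multiset.countP_eq_zero.2 fun x hx => by
            have := le_of_mem_leaves (l := l') (by simpa using hl) hx
            omega
        rw [hz, add_zero] at h0
        obtain ⟨s, hs, hs'⟩ := ih l' (i + 1) F (by simp [size] at hw ⊢; omega) hL.2 hl.2
          (fun x hx => by simpa [add_assoc, add_comm, add_left_comm] using hK.2 x hx)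
          (by simp [leafDepths] at hn; omega) (fun x => by
            have := hD x
            simp only [leaves_cons_leaf, Multiset.countP_cons] at this
            split_ifs at this <;> omega)
        refine ⟨s, .head ⟨k - 1 + 1, ?_⟩ hs, hs'⟩
        simpa using Step.leaf h0
      | node a b T T' =>
        obtain ⟨⟨ha, hb, hab, hT, hT'⟩, hL⟩ := hL
        rw [leaves_split] at hn hD
        have e : l' + (k - 1 + 1 - a) = l' + b := by omega
        have hcard := card_le_card_leaves ((l' + a, T) ::ₘ (l' + b, T') ::ₘ F)
        simp only [Multiset.card_cons] at hcard
        have hk' : (k - 1) * (i + (F.card + 1 + 1)) = (k - 1) * (i + (F.card + 1)) + (k - 1) := by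
          ring
        obtain ⟨s, hs, hs'⟩ := ih l' i ((l' + a, T) ::ₘ (l' + b, T') ::ₘ F)
          (by simp only [Multiset.map_cons, Multiset.sum_cons, size] at hw ⊢; omega)
          (by simpa using ⟨hT, hT', fun a b h => hL (a, b) h⟩)
          (by simpa using fun a b h => hl.2 (a, b) h)
          (by
            simp only [Multiset.mem_cons, forall_eq_or_imp, Multiset.card_cons, hk']
            refine ⟨by omega, by omega, fun x hx => ?_⟩
            have := hK.2 x hx
            omega) hn hD
        refine ⟨s, .head ⟨a, ?_⟩ hs, hs'⟩
        simp only [Multiset.map_cons, ← e]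
        exact Step.split ha (by omega) (by simp; omega)
    · rcases F.empty_or_exists_mem with rfl | ⟨x, hx⟩
      · exact ⟨_, .refl, by simpa using hn⟩
      have hlt : ∀ x ∈ F, l + 1 ≤ x.1 := fun x hx => by
        have := hl x hx
        have : l ≠ x.1 := fun h => hF (h ▸ Multiset.mem_map_of_mem _ hx)
        omega
      have hc := card_le_card_leaves F
      have hpos : 0 < F.card := Multiset.card_pos.2 (fun h => by simp [h] at hx)
      -- Some root lies strictly above `l`, and the bound on root levels keeps it within `(k - 1) *
      -- n`.
      have hln : l < (k - 1) * n := by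
        have h1 := hlt x hx
        have h2 := hK x hx
        have h3 : (k - 1) * (i + F.card) ≤ (k - 1) * n := Nat.mul_le_mul_left _ (by omega)
        omega
      obtain ⟨s, hs, hs'⟩ := ih (l + 1) i F (by omega) hL hlt hK hn hD
      exact ⟨s, .head ⟨0, Step.shift hF (by omega) hln⟩ hs, hs'⟩

theorem exists_reachable_of_realizable (h : Realizable k D) :
    ∃ s, Relation.ReflTransGen (fun s s' => ∃ mv, Step D.card (k - 1) D mv s s') start s ∧
      s.done = D.card := by
  obtain ⟨T, hT, hM⟩ := h
  have := exists_reachable_done (k := k) (n := D.card) (D := D) _ 0 0 {(0, T)} le_rfl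
    (by simpa using hT) (by simp) (by simp) (by simpa [leaves] using Multiset.card_eq_card_of_rel hM)
    (by simpa [leaves] using hM.countP_lt_le)
  simpa [start] using this

/-- The forest `F` completes the configuration `s` to a forest whose leaves meet `D`. -/
structure Completes (k n : ℕ) (D : Multiset ℕ) (s : Conf) (F : Multiset (ℕ × LTree)) : Prop where
  map_fst : F.map Prod.fst = s.pend
  isL : ∀ x ∈ F, x.2.IsL k
  card : s.done + (leaves F).card = n
  countP_le : ∀ x, D.countP (· < x) ≤ s.done + (leaves F).countP (· < x)

variable {l i a : ℕ} {M : Multiset ℕ} {F : Multiset (ℕ × LTree)}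

theorem completes_zero (hD : D.card = n) (l : ℕ) : Completes k n D ⟨l, n, 0⟩ 0 :=
  ⟨by simp, by simp, by simp, fun x => by simpa [hD] using Multiset.countP_le_card (· < x) D⟩

theorem Completes.shift (h : Completes k n D ⟨l + 1, i, M⟩ F) : Completes k n D ⟨l, i, M⟩ F :=
  ⟨h.1, h.2, h.3, h.4⟩

/-- For thresholds above `l` the new leaf is counted in place of the finished one. For thresholds up
to `l` monotonicity reduces to the guard at `l`. -/
theorem Completes.leaf (h : Completes k n D ⟨l, i + 1, M⟩ F) (hD : D.countP (· < l) ≤ i) :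
    Completes k n D ⟨l, i, l ::ₘ M⟩ ((l, .leaf) ::ₘ F) := by
  refine ⟨by simpa using h.1, by simpa [IsL] using h.2, ?_, fun x => ?_⟩
  · have := h.3
    simp [leafDepths] at this ⊢
    omega
  · have h1 := h.4 x
    simp only [leaves_cons_leaf, Multiset.countP_cons] at h1 ⊢
    split_ifs with hx
    · omega
    · have : D.countP (· < x) ≤ D.countP (· < l) := by
        rw [Multiset.countP_eq_card_filter, Multiset.countP_eq_card_filter]
        exact Multiset.card_le_card (Multiset.monotone_filter_right D fun y hy => by omega)
      omega

theorem Completes.split {b : ℕ} {T T' : LTree}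
    (h : Completes k n D ⟨l, i, (l + a) ::ₘ (l + b) ::ₘ M⟩ ((l + a, T) ::ₘ (l + b, T') ::ₘ F))
    (ha : 1 ≤ a) (hb : 1 ≤ b) (hab : a + b = k) :
    Completes k n D ⟨l, i, l ::ₘ M⟩ ((l, .node a b T T') ::ₘ F) := by
  obtain ⟨h₁, h₂, h₃, h₄⟩ := h
  refine ⟨?_, ?_, by rwa [leaves_split], by rwa [leaves_split]⟩
  · simpa using h₁
  · simp only [Multiset.mem_cons, forall_eq_or_imp] at h₂ ⊢
    exact ⟨⟨ha, hb, hab, h₂.1, h₂.2.1⟩, h₂.2.2⟩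

theorem Completes.exists_tree (h : Completes k n D start F) (hD : D.card = n) :
    ∃ T, F = {(0, T)} ∧ T.IsL k ∧ T.Meets D := by
  obtain ⟨h₁, h₂, h₃, h₄⟩ := h
  obtain ⟨⟨l, T⟩, rfl, hl⟩ := Multiset.map_eq_singleton.1 h₁
  simp only [start] at hl h₃ h₄
  subst hl
  refine ⟨T, rfl, h₂ (0, T) (by simp), Multiset.rel_le_of_countP_lt_le D ?_ ?_⟩
  · simpa [leaves, hD] using h₃
  · simpa [leaves] using h₄

end Conf

/-! ### Coding the pending levels as a number in base `n + 2` -/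

/-- The code of a multiset `M` of levels in `[l, l + K]`: a number with digits in base `n + 2`. -/
def levelCode (n K l : ℕ) (M : Multiset ℕ) : ℕ :=
  (M.map fun x => (n + 2) ^ (K + l - x)).sum

section levelCode

variable {n K l : ℕ} {M M' : Multiset ℕ}

@[simp]
theorem levelCode_zero : levelCode n K l 0 = 0 := rfl

theorem levelCode_cons (x : ℕ) :
    levelCode n K l (x ::ₘ M) = (n + 2) ^ (K + l - x) + levelCode n K l M := by
  simp [levelCode]

theorem levelCode_cons_self :
    levelCode n K l (l ::ₘ M) = (n + 2) ^ K + levelCode n K l M := by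
  simp [levelCode_cons]

theorem levelCode_le {e : ℕ} (h : ∀ x ∈ M, K + l - x ≤ e) :
    levelCode n K l M ≤ M.card * (n + 2) ^ e := by
  rw [← smul_eq_mul, ← Multiset.card_map (fun x => (n + 2) ^ (K + l - x)) M]
  refine Multiset.sum_le_card_nsmul _ _ fun y hy => ?_
  obtain ⟨x, hx, rfl⟩ := Multiset.mem_map.1 hy
  exact Nat.pow_le_pow_right (by omega) (h x hx)

theorem levelCode_lt (h : ∀ x ∈ M, l ≤ x) (hM : M.card ≤ n) :
    levelCode n K l M < (n + 2) ^ (K + 1) := by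
  have h1 := levelCode_le (n := n) (K := K) (l := l) (M := M) (e := K)
    (fun x hx => by have := h x hx; omega)
  have h2 : M.card * (n + 2) ^ K ≤ n * (n + 2) ^ K := Nat.mul_le_mul_right _ hM
  have h3 : 0 < (n + 2) ^ K := by positivity
  rw [pow_succ]
  nlinarith

theorem levelCode_lt_of_notMem (h : ∀ x ∈ M, l ≤ x) (h' : ∀ x ∈ M, x ≤ l + K) (hM : M.card ≤ n)
    (hl : l ∉ M) : levelCode n K l M < (n + 2) ^ K := by
  have hlt : ∀ x ∈ M, l < x := fun x hx => lt_of_le_of_ne (h x hx) fun e => hl (e ▸ hx)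
  cases K with
  | zero =>
    have : M = 0 := Multiset.eq_zero_of_forall_notMem fun x hx => by
      have := hlt x hx
      have := h' x hx
      omega
    simp [this]
  | succ K =>
    have h1 := levelCode_le (n := n) (K := K + 1) (l := l) (M := M) (e := K)
      (fun x hx => by have := hlt x hx; omega)
    have h2 : M.card * (n + 2) ^ K ≤ n * (n + 2) ^ K := Nat.mul_le_mul_right _ hM
    have h3 : 0 < (n + 2) ^ K := by positivity
    rw [pow_succ]
    nlinarith

/-- Without `l` there are at most `n` summands, each at most `(n + 2) ^ (K - 1)` if `K` is positive,
and none if `K = 0`. So the machine tests for a pending node at the current level by one comparison.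
-/
theorem pow_le_levelCode_iff (h : ∀ x ∈ M, l ≤ x) (h' : ∀ x ∈ M, x ≤ l + K) (hM : M.card ≤ n) :
    (n + 2) ^ K ≤ levelCode n K l M ↔ l ∈ M := by
  constructor
  · intro h1
    by_contra hl
    have := levelCode_lt_of_notMem h h' hM hl
    omega
  · intro hl
    obtain ⟨M, rfl⟩ := Multiset.exists_cons_of_mem hl
    rw [levelCode_cons_self]
    omega

/-- Moving the window up by one level moves every digit up by one place, so a level shift costs a
single multiplication. -/
theorem levelCode_succ_left (h' : ∀ x ∈ M, x ≤ l + K) :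
    levelCode n K (l + 1) M = levelCode n K l M * (n + 2) := by
  rw [levelCode, levelCode, ← Multiset.sum_map_mul_right]
  refine congrArg _ (Multiset.map_congr rfl fun x hx => ?_)
  rw [← pow_succ]
  congr 1
  have := h' x hx
  omega

/-- The leading-digit test decides whether `l` occurs. If so, one copy is removed on both sides; if
not, both multisets lie in the smaller window that starts at `l + 1`. -/
theorem levelCode_injective :
    ∀ {K l : ℕ} {M M' : Multiset ℕ}, (∀ x ∈ M, l ≤ x) → (∀ x ∈ M', l ≤ x) →
      (∀ x ∈ M, x ≤ l + K) → (∀ x ∈ M', x ≤ l + K) → M.card ≤ n → M'.card ≤ n →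
      levelCode n K l M = levelCode n K l M' → M = M' := by
  intro K
  induction K with
  | zero =>
    intro l M M' h₁ h₁' h₂ h₂' _ _ h
    have key : ∀ {M : Multiset ℕ}, (∀ x ∈ M, l ≤ x) → (∀ x ∈ M, x ≤ l + 0) →
        M = Multiset.replicate (levelCode n 0 l M) l := by
      intro M h₁ h₂
      have hx : M = Multiset.replicate M.card l := Multiset.eq_replicate_card.2 fun x hx => by
        have := h₁ x hx
        have := h₂ x hx
        omega
      have h0 : levelCode n 0 l M = M.card := by
        rw [hx]
        simp [levelCode]
      rw [h0]
      exact hx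
    rw [key h₁ h₂, key h₁' h₂', h]
  | succ K ih =>
    intro l M M'
    induction hm : M.card generalizing M M' with
    | zero =>
      intro h₁ h₁' h₂ h₂' _ _ h
      rw [Multiset.card_eq_zero] at hm
      subst hm
      rw [levelCode_zero] at h
      symm
      refine Multiset.eq_zero_of_forall_notMem fun x hx => ?_
      obtain ⟨N, rfl⟩ := Multiset.exists_cons_of_mem hx
      rw [levelCode_cons] at h
      have : 0 < (n + 2) ^ (K + 1 + l - x) := by positivity
      omega
    | succ m ihm =>
      intro h₁ h₁' h₂ h₂' hM hM' h
      by_cases hl : l ∈ M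
      · have hl' : l ∈ M' := by
          rwa [← pow_le_levelCode_iff h₁' h₂' hM', ← h, pow_le_levelCode_iff h₁ h₂ (hm ▸ hM)]
        obtain ⟨N, rfl⟩ := Multiset.exists_cons_of_mem hl
        obtain ⟨N', rfl⟩ := Multiset.exists_cons_of_mem hl'
        rw [levelCode_cons, levelCode_cons, add_right_inj] at h
        simp only [Multiset.mem_cons, forall_eq_or_imp, Multiset.card_cons] at *
        rw [ihm (by omega) h₁.2 h₁'.2 h₂.2 h₂'.2 (by omega) (by omega) h]
      · have hl' : l ∉ M' := by
          rwa [← pow_le_levelCode_iff h₁' h₂' hM', ← h, pow_le_levelCode_iff h₁ h₂ (hm ▸ hM)]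
        have e : K + 1 + l = K + (l + 1) := by omega
        refine ih (l := l + 1) (fun x hx => ?_) (fun x hx => ?_) (fun x hx => ?_) (fun x hx => ?_)
          (hm ▸ hM) hM' ?_
        · exact lt_of_le_of_ne (h₁ x hx) fun e => hl (e ▸ hx)
        · exact lt_of_le_of_ne (h₁' x hx) fun e => hl' (e ▸ hx)
        · have := h₂ x hx; omega
        · have := h₂' x hx; omega
        · simpa only [levelCode, e] using h

end levelCode

/-! ### Table addresses, which decrease along every step -/

namespace Conf

/-- The number of memory cells for all configurations with the same level and the same number of
finished leaves. -/
def row (n K : ℕ) : ℕ := 8 * (n + 2) ^ (K + 1)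

/-- The first address behind the table. -/
def tableEnd (n K : ℕ) : ℕ := n + K + row n K * (n + 1) * (K * n + 1)

/-- The address of the record of a configuration in the table. -/
def addr (n K : ℕ) (s : Conf) : ℕ :=
  n + K + row n K * (n + 1) * (K * n - s.lev) + row n K * (n - s.done) +
    8 * levelCode n K s.lev s.pend

variable {n K mv : ℕ} {D : Multiset ℕ} {s s' : Conf}

theorem Valid.card_pend_le (h : s.Valid n K) : s.pend.card ≤ n := by
  have := h.card_le
  omega

theorem Valid.levelCode_lt (h : s.Valid n K) :
    8 * levelCode n K s.lev s.pend < row n K := by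
  have := _root_.levelCode_lt (K := K) h.le_pend h.card_pend_le
  rw [row]
  omega

theorem Valid.addr_lt (h : s.Valid n K) : addr n K s < tableEnd n K := by
  have h1 := h.levelCode_lt
  have h2 : row n K * (n + 1) * (K * n - s.lev) ≤ row n K * (n + 1) * (K * n) :=
    Nat.mul_le_mul_left _ (Nat.sub_le _ _)
  have h3 : row n K * (n - s.done) ≤ row n K * n := Nat.mul_le_mul_left _ (Nat.sub_le _ _)
  rw [addr, tableEnd, mul_add, mul_one]
  linarith

/-- Records are aligned to blocks of eight cells behind the input and the powers, so distinct
records cannot overlap. -/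
theorem exists_addr_eq (s : Conf) : ∃ x, addr n K s = n + K + 8 * x := by
  refine ⟨(n + 2) ^ (K + 1) * (n + 1) * (K * n - s.lev) + (n + 2) ^ (K + 1) * (n - s.done) +
    levelCode n K s.lev s.pend, ?_⟩
  rw [addr, row]
  ring

/-- Division with remainder by `row n K` and then by `n + 1` recovers the three digits; the
truncated differences are exact on valid configurations. -/
theorem addr_injective (hs : s.Valid n K) (hs' : s'.Valid n K) (h : addr n K s = addr n K s') :
    s = s' := by
  have hr : 0 < row n K := by unfold row; positivity
  have key : ∀ {s : Conf}, s.Valid n K →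
      addr n K s = n + K + (8 * levelCode n K s.lev s.pend +
        row n K * ((n - s.done) + (n + 1) * (K * n - s.lev))) := by
    intro s hs
    rw [addr]
    ring
  rw [key hs, key hs', add_right_inj] at h
  have e1 := congrArg (· % row n K) h
  have e2 := congrArg (· / row n K) h
  simp only [Nat.add_mul_mod_self_left, Nat.mod_eq_of_lt hs.levelCode_lt,
    Nat.mod_eq_of_lt hs'.levelCode_lt] at e1
  simp only [Nat.add_mul_div_left _ _ hr, Nat.div_eq_of_lt hs.levelCode_lt,
    Nat.div_eq_of_lt hs'.levelCode_lt, zero_add] at e2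
  have e3 := congrArg (· % (n + 1)) e2
  have e4 := congrArg (· / (n + 1)) e2
  simp only [Nat.add_mul_mod_self_left, Nat.mod_eq_of_lt (show n - s.done < n + 1 by omega),
    Nat.mod_eq_of_lt (show n - s'.done < n + 1 by omega)] at e3
  simp only [Nat.add_mul_div_left _ _ (Nat.succ_pos n),
    Nat.div_eq_of_lt (show n - s.done < n + 1 by omega),
    Nat.div_eq_of_lt (show n - s'.done < n + 1 by omega), zero_add] at e4
  have a1 := hs.lev_le
  have a2 := hs'.lev_le
  have a3 := hs.card_le
  have a4 := hs'.card_le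
  obtain ⟨l, i, M⟩ := s
  obtain ⟨l', i', M'⟩ := s'
  simp only at *
  obtain rfl : l = l' := by omega
  obtain rfl : i = i' := by omega
  have := levelCode_injective hs.le_pend hs'.le_pend hs.pend_le hs'.pend_le hs.card_pend_le
    hs'.card_pend_le (by simpa using e1)
  simp only at this
  rw [this]

section

variable {l i a : ℕ} {M : Multiset ℕ}

theorem addr_leaf (h : Valid n K ⟨l, i, l ::ₘ M⟩) :
    addr n K ⟨l, i, l ::ₘ M⟩ = addr n K ⟨l, i + 1, M⟩ + row n K + 8 * (n + 2) ^ K := by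
  have := h.card_le
  simp only [Multiset.card_cons] at this
  obtain ⟨j, hj⟩ : ∃ j, n - i = j + 1 := ⟨n - i - 1, by omega⟩
  have hj' : n - (i + 1) = j := by omega
  simp only [addr, levelCode_cons_self, hj, hj']
  ring

/-- The subtracted term stands on the left as a summand, which avoids truncated subtraction and
suits `omega`. -/
theorem addr_split (ha : 1 ≤ a) (haK : a ≤ K) :
    addr n K ⟨l, i, (l + a) ::ₘ (l + (K + 1 - a)) ::ₘ M⟩ + 8 * (n + 2) ^ K =
      addr n K ⟨l, i, l ::ₘ M⟩ + (8 * (n + 2) ^ (K - a) + 8 * (n + 2) ^ (a - 1)) := by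
  have e1 : K + l - (l + a) = K - a := by omega
  have e2 : K + l - (l + (K + 1 - a)) = a - 1 := by omega
  simp only [addr, levelCode_cons_self, levelCode_cons, e1, e2]
  ring

theorem levelCode_split (ha : 1 ≤ a) (haK : a ≤ K) :
    levelCode n K l ((l + a) ::ₘ (l + (K + 1 - a)) ::ₘ M) =
      levelCode n K l M + ((n + 2) ^ (K - a) + (n + 2) ^ (a - 1)) := by
  have e1 : K + l - (l + a) = K - a := by omega
  have e2 : K + l - (l + (K + 1 - a)) = a - 1 := by omega
  simp only [levelCode_cons, e1, e2]
  ring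

/-- Both exponents are at most `K - 1` and the base is at least `3`, so two smaller powers stay
below the next one. -/
theorem pow_add_pow_lt (n : ℕ) (hn : 1 ≤ n) (ha : 1 ≤ a) (haK : a ≤ K) :
    (n + 2) ^ (K - a) + (n + 2) ^ (a - 1) < (n + 2) ^ K := by
  obtain ⟨K, rfl⟩ : ∃ K', K = K' + 1 := ⟨K - 1, by omega⟩
  have h1 : (n + 2) ^ (K + 1 - a) ≤ (n + 2) ^ K := Nat.pow_le_pow_right (by omega) (by omega)
  have h2 : (n + 2) ^ (a - 1) ≤ (n + 2) ^ K := Nat.pow_le_pow_right (by omega) (by omega)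
  have h3 : 0 < (n + 2) ^ K := by positivity
  rw [pow_succ]
  nlinarith

theorem addr_shift (h : Valid n K ⟨l, i, M⟩) (hl : l < K * n) :
    addr n K ⟨l + 1, i, M⟩ + row n K * (n + 1) + 8 * levelCode n K l M =
      addr n K ⟨l, i, M⟩ + 8 * levelCode n K l M * (n + 2) := by
  obtain ⟨j, hj⟩ : ∃ j, K * n - l = j + 1 := ⟨K * n - l - 1, by omega⟩
  have hj' : K * n - (l + 1) = j := by omega
  simp only [addr, levelCode_succ_left h.pend_le, hj, hj']
  ring

end

/-- A shift lowers the most significant digit, and its larger code still fits into one row. A leaf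
lowers the digit of unfinished leaves as well as the code. A split replaces a power in the code by
two powers with a smaller sum. -/
theorem Step.addr_lt (h : Step n K D mv s s') (hs : s.Valid n K) :
    addr n K s' < addr n K s := by
  have hn : 1 ≤ n := hs.card_pos.trans hs.card_le
  have hs' := h.valid hs
  have hr : 0 < row n K := by unfold row; positivity
  cases h with
  | shift hM hi hl =>
    have h1 := addr_shift hs hl
    have h2 := hs'.levelCode_lt
    simp only [levelCode_succ_left hs.pend_le] at h2
    have h3 : row n K ≤ row n K * (n + 1) := Nat.le_mul_of_pos_right _ (by omega)
    rw [← mul_assoc] at h2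
    omega
  | leaf =>
    have := addr_leaf hs
    omega
  | @split a l i M ha haK =>
    have h1 := addr_split (n := n) (l := l) (i := i) (M := M) ha haK
    have h2 := pow_add_pow_lt n hn ha haK
    omega

end Conf

open RAM

/-! ### Records in memory, predecessor chains and the table invariant -/

namespace Conf

/-- The record of the configuration `s` in the memory `m`. -/
structure Rec (n K : ℕ) (m : ℕ → ℕ) (s : Conf) : Prop where
  valid : s.Valid n K
  mark : m (addr n K s) = s.done + s.pend.card
  lev : m (addr n K s + 1) = s.lev
  done : m (addr n K s + 2) = s.done
  code : m (addr n K s + 3) = 8 * levelCode n K s.lev s.pend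

/-- The records in the memory `m` describe a sequence of `j` steps from the start configuration
to `s`. -/
inductive Chain (n K : ℕ) (D : Multiset ℕ) (m : ℕ → ℕ) : ℕ → Conf → Prop where
  | start (hr : Rec n K m start) (hp : m (addr n K start + 4) = 0) : Chain n K D m 0 start
  | step {j mv : ℕ} {s s' : Conf} (hc : Chain n K D m j s) (hs : Step n K D mv s s')
      (hr : Rec n K m s') (hp : m (addr n K s' + 4) = addr n K s)
      (hm : m (addr n K s' + 5) = mv) : Chain n K D m (j + 1) s'

/-- The invariant of the memory while the table is filled. -/
structure Table (n K : ℕ) (d : List ℕ) (m : ℕ → ℕ) : Prop where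
  input : ∀ p < n, m p = d.getD p 0
  pow : ∀ j < K, m (n + j) = 8 * (n + 2) ^ j
  chain : ∀ x, m (n + K + 8 * x) ≠ 0 → ∃ j s, Chain n K d m j s ∧ addr n K s = n + K + 8 * x
  start : m (addr n K start) ≠ 0

/-- Existing records are not changed, and new ones have addresses below `b`. -/
structure Grows (n K b : ℕ) (m m' : ℕ → ℕ) : Prop where
  record : ∀ x, m (n + K + 8 * x) ≠ 0 → ∀ f < 8, m' (n + K + 8 * x + f) = m (n + K + 8 * x + f)
  mark : ∀ x, b ≤ n + K + 8 * x → m' (n + K + 8 * x) = m (n + K + 8 * x)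

variable {n K b j mv : ℕ} {D : Multiset ℕ} {d : List ℕ} {m m' m'' : ℕ → ℕ} {s s' : Conf}

theorem Grows.refl (n K b : ℕ) (m : ℕ → ℕ) : Grows n K b m m :=
  ⟨fun _ _ _ _ => rfl, fun _ _ => rfl⟩

theorem Grows.marked (h : Grows n K b m m') {s : Conf} (hs : m (addr n K s) ≠ 0) :
    m' (addr n K s) ≠ 0 := by
  obtain ⟨x, hx⟩ := exists_addr_eq (n := n) (K := K) s
  rw [hx] at hs ⊢
  rw [← add_zero (n + K + 8 * x), h.record x hs 0 (by omega)]
  exact hs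

theorem Grows.trans (h : Grows n K b m m') (h' : Grows n K b m' m'') : Grows n K b m m'' := by
  refine ⟨fun x hx f hf => ?_, fun x hx => (h'.2 x hx).trans (h.2 x hx)⟩
  have h0 : m' (n + K + 8 * x) ≠ 0 := by
    have := h.1 x hx 0 (by omega)
    rw [add_zero] at this
    rwa [this]
  exact (h'.1 x h0 f hf).trans (h.1 x hx f hf)

/-- A valid configuration has at least one finished or pending node, so this entry doubles as the
flag that a record exists. -/
theorem Rec.mark_ne_zero (h : Rec n K m s) : m (addr n K s) ≠ 0 := by
  have := h.valid.card_pos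
  rw [h.mark]
  omega

theorem Rec.congr (h : Rec n K m s) (hm : ∀ f < 8, m' (addr n K s + f) = m (addr n K s + f)) :
    Rec n K m' s := by
  obtain ⟨h₁, h₂, h₃, h₄, h₅⟩ := h
  refine ⟨h₁, ?_, ?_, ?_, ?_⟩
  · rw [← h₂]; exact hm 0 (by omega)
  · rw [hm 1 (by omega), h₃]
  · rw [hm 2 (by omega), h₄]
  · rw [hm 3 (by omega), h₅]

theorem Chain.toRec (h : Chain n K D m j s) : Rec n K m s := by
  cases h <;> assumption

theorem Chain.congr (h : Chain n K D m j s)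
    (hm : ∀ s, Rec n K m s → ∀ f < 8, m' (addr n K s + f) = m (addr n K s + f)) :
    Chain n K D m' j s := by
  induction h with
  | start hr hp => exact .start (hr.congr (hm _ hr)) (by rw [hm _ hr 4 (by omega), hp])
  | step _ hs hr hp hm' ih =>
    exact .step ih hs (hr.congr (hm _ hr)) (by rw [hm _ hr 4 (by omega), hp])
      (by rw [hm _ hr 5 (by omega), hm'])

theorem Chain.grows (h : Chain n K D m j s) (hg : Grows n K b m m') : Chain n K D m' j s := by
  refine h.congr fun s hs f hf => ?_
  have := hs.mark_ne_zero
  obtain ⟨x, hx⟩ := exists_addr_eq (n := n) (K := K) s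
  rw [hx] at this ⊢
  exact hg.record x this f hf

/-- Addresses fall by at least one per step. This bounds the length of the path to be undone and
shows that no record lies above the start. -/
theorem Chain.add_le (h : Chain n K D m j s) : addr n K s + j ≤ addr n K Conf.start := by
  induction h with
  | start => simp
  | step hc hs _ _ _ ih =>
    have := hs.addr_lt hc.toRec.valid
    omega

/-- The memory after writing a record. -/
def writeRec (m : ℕ → ℕ) (A c l i q p mv : ℕ) : ℕ → ℕ :=
  Function.update (Function.update (Function.update (Function.update (Function.update
    (Function.update m A c) (A + 1) l) (A + 2) i) (A + 3) q) (A + 4) p) (A + 5) mv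

theorem writeRec_of_ne {A c l i q p mv y : ℕ} (h : y < A ∨ A + 8 ≤ y) :
    writeRec m A c l i q p mv y = m y := by
  unfold writeRec
  repeat rw [Function.update_of_ne (by omega)]

theorem Table.writeRec (h : Table n K d m) (hc : Chain n K d m j s) (hs : Step n K d mv s s')
    (h0 : m (addr n K s') = 0) (hm' : m' = writeRec m (addr n K s') (s'.done + s'.pend.card) s'.lev
      s'.done (8 * levelCode n K s'.lev s'.pend) (addr n K s) mv) :
    Table n K d m' ∧ Grows n K (addr n K s) m m' ∧ m' (addr n K s') ≠ 0 := by
  obtain ⟨x', hx'⟩ := exists_addr_eq (n := n) (K := K) s'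
  have hlt := hs.addr_lt hc.toRec.valid
  have hg : Grows n K (addr n K s) m m' := by
    subst hm'
    constructor
    · intro x hx f hf
      have : x ≠ x' := by
        rintro rfl
        exact hx (hx' ▸ h0)
      exact writeRec_of_ne (by omega)
    · intro x hx
      exact writeRec_of_ne (by omega)
  have hr : Rec n K m' s' := by
    refine ⟨hs.valid hc.toRec.valid, ?_, ?_, ?_, ?_⟩ <;>
      simp [hm', Conf.writeRec]
  have hc' : Chain n K d m' (j + 1) s' :=
    .step (hc.grows hg) hs hr (by simp [hm', Conf.writeRec])
      (by simp [hm', Conf.writeRec])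
  refine ⟨⟨fun p hp => ?_, fun p hp => ?_, fun x hx => ?_, hg.marked h.start⟩, hg, hr.mark_ne_zero⟩
  · rw [hm', writeRec_of_ne (by omega), h.input p hp]
  · rw [hm', writeRec_of_ne (by omega), h.pow p hp]
  · by_cases hxx : x = x'
    · subst hxx
      exact ⟨_, _, hc', hx'⟩
    · rw [hm', writeRec_of_ne (by omega)] at hx
      obtain ⟨j, t, ht, hx⟩ := h.chain x hx
      exact ⟨j, t, ht.grows hg, hx⟩

/-- The values of the registers that are constant after the initialization. -/
structure Env (n K : ℕ) (r : ℕ → ℕ) : Prop where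
  r0 : r 0 = n
  r2 : r 2 = 1
  r3 : r 3 = K
  r4 : r 4 = n + 2
  r5 : r 5 = 8 * (n + 2) ^ K
  r6 : r 6 = row n K
  r7 : r 7 = row n K * (n + 1)
  r8 : r 8 = K * n
  r9 : r 9 = n + K
  r10 : r 10 = tableEnd n K
  r11 : r 11 = 8

theorem Env.congr {r r' : ℕ → ℕ} (h : Env n K r) (hr : ∀ x < 12, r' x = r x) : Env n K r' := by
  obtain ⟨h0, h2, h3, h4, h5, h6, h7, h8, h9, h10, h11⟩ := h
  constructor <;> rw [hr _ (by omega)] <;> assumption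

/-- The machine is about to process the record of `s`. -/
structure Cur (n K : ℕ) (d : List ℕ) (s : Conf) (σ : State) : Prop where
  env : Env n K σ.reg
  table : Table n K d σ.mem
  chain : ∃ j, Chain n K d σ.mem j s
  r14 : σ.reg 14 = addr n K s
  r15 : σ.reg 15 = s.done + s.pend.card
  r16 : σ.reg 16 = s.lev
  r17 : σ.reg 17 = s.done
  r18 : σ.reg 18 = 8 * levelCode n K s.lev s.pend

theorem Cur.congr {σ σ' : State} (h : Cur n K d s σ) (hr : ∀ x < 19, σ'.reg x = σ.reg x)
    (ht : Table n K d σ'.mem) (hg : Grows n K b σ.mem σ'.mem) : Cur n K d s σ' := by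
  obtain ⟨h1, h2, ⟨j, h3⟩, h4, h5, h6, h7, h8⟩ := h
  refine ⟨h1.congr fun x hx => hr x (by omega), ht, ⟨j, h3.grows hg⟩, ?_, ?_, ?_, ?_, ?_⟩ <;>
    rw [hr _ (by omega)] <;> assumption

/-- Write the record described by the registers 20 to 25, with parent 14, unless there is one. -/
def markProg : Prog :=
  .seq (.load 27 20) (.branch 27 .skip (.block [
    .store 20 21, .add 26 20 2, .store 26 22, .add 26 26 2, .store 26 23, .add 26 26 2,
    .store 26 24, .add 26 26 2, .store 26 14, .add 26 26 2, .store 26 25]))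

/-- An existing record is left alone: any one predecessor suffices to recover a path, so the first
one found is kept. -/
theorem tri_markProg {σ : State} (h : Cur n K d s σ) (hs : Step n K d mv s s')
    (h20 : σ.reg 20 = addr n K s') (h21 : σ.reg 21 = s'.done + s'.pend.card)
    (h22 : σ.reg 22 = s'.lev) (h23 : σ.reg 23 = s'.done)
    (h24 : σ.reg 24 = 8 * levelCode n K s'.lev s'.pend) (h25 : σ.reg 25 = mv) :
    Tri markProg σ 14 fun σ' => Cur n K d s σ' ∧ Grows n K (addr n K s) σ.mem σ'.mem ∧
      (∀ x < 26, σ'.reg x = σ.reg x) ∧ σ'.reg 28 = σ.reg 28 ∧ σ'.mem (addr n K s') ≠ 0 := by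
  have key : Tri markProg σ 14 fun σ' => Table n K d σ'.mem ∧
      Grows n K (addr n K s) σ.mem σ'.mem ∧ σ'.mem (addr n K s') ≠ 0 := by
    refine Tri.mono (Tri.of_loopFree rfl (Q := fun σ' => Table n K d σ'.mem ∧
      Grows n K (addr n K s) σ.mem σ'.mem ∧ σ'.mem (addr n K s') ≠ 0) ?_) (by decide)
      fun _ h => h
    simp only [markProg, Prog.run, Prog.block, State.reg_setReg, State.reg_setMem,
      reduceIte, h20]
    by_cases h0 : σ.mem (addr n K s') = 0
    · obtain ⟨j, hc⟩ := h.chain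
      rw [if_pos h0]
      refine h.table.writeRec hc hs h0 ?_
      simp [State.mem_setReg, State.mem_setMem, h21, h22, h23, h24, h25, h.r14, h.env.r2, Conf.writeRec, add_assoc]
    · rw [if_neg h0]
      exact ⟨h.table, Grows.refl _ _ _ _, h0⟩
  refine key.frame.mono le_rfl ?_
  rintro σ' ⟨⟨h1, h2, h3⟩, h4⟩
  have h5 : ∀ x < 26, σ'.reg x = σ.reg x := fun x hx =>
    h4 x (Prog.keeps_of_writesGE hx (by decide))
  exact ⟨h.congr (fun x hx => h5 x (by omega)) h1 h2, h2, h5, h4 28 (by decide), h3⟩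

end Conf

/-! ### Programs for the leaf, split and level steps -/

namespace Conf

variable {n K b j mv : ℕ} {d : List ℕ} {s s' : Conf} {σ : State}

/-- Count in register 29 the input numbers that are smaller than register 16. -/
def countProg : Prog :=
  .seq (.block [.copy 28 0, .const 29 0]) (.loop 28 (.block [
    .sub 28 28 2, .load 27 28, .sub 27 16 27, .branch 27 (.add 29 29 2) .skip]))

/-- The input is unsorted, so each leaf test scans it completely. This is a linear cost per record.
-/
theorem tri_countProg (h : Cur n K d s σ) (hd : d.length = n) :
    Tri countProg σ (n * 7 + 4) fun σ' => σ'.reg 29 = (d : Multiset ℕ).countP (· < s.lev) ∧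
      Cur n K d s σ' ∧ σ'.mem = σ.mem ∧ ∀ x < 19, σ'.reg x = σ.reg x := by
  have key : Tri countProg σ (n * 7 + 4) fun σ' =>
      σ'.reg 29 = (d : Multiset ℕ).countP (· < s.lev) := by
    refine Tri.mono (T := 3 + (n * (6 + 1) + 1)) (Q := fun σ' => σ'.reg 29 =
      (d : Multiset ℕ).countP (· < s.lev)) ?_ (by omega) fun _ h => h
    refine Tri.seq (Q := fun σ' => σ'.reg 28 = n ∧ σ'.reg 29 = 0 ∧ σ'.reg 2 = 1 ∧
      σ'.reg 16 = s.lev ∧ σ'.mem = σ.mem) (Tri.of_loopFree rfl ?_) ?_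
    · simp [Prog.run, Prog.block, State.reg_setReg, State.mem_setReg, h.env.r0, h.env.r2, h.r16]
    intro σ₁ h₁
    refine Tri.mono (Tri.loop (I := fun j σ' => σ'.reg 28 = j ∧ j ≤ n ∧
      σ'.reg 29 = (d.drop j).countP (· < s.lev) ∧ σ'.reg 2 = 1 ∧
      σ'.reg 16 = s.lev ∧ σ'.mem = σ.mem) ?_ ?_ n σ₁ ?_) le_rfl ?_
    · exact fun σ' h => h.1
    · rintro j σ' ⟨h28, hj, h29, h2, h16, hm⟩
      refine ⟨by omega, Tri.of_loopFree rfl ?_⟩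
      have hjd : j < d.length := by omega
      have hval : σ.mem j = d[j] := by
        rw [h.table.input j (by omega), List.getD_eq_getElem _ _ hjd]
      have hif : (d.drop j).countP (· < s.lev) =
          (d.drop (j + 1)).countP (· < s.lev) + if d[j] < s.lev then 1 else 0 := by
        rw [List.drop_eq_getElem_cons hjd, List.countP_cons]
        simp
      by_cases hlt : d[j] < s.lev
      · have : s.lev - d[j] ≠ 0 := by omega
        simp [Prog.run, Prog.block, State.reg_setReg, State.mem_setReg, h28, h2, hm, h16, h29, hval,
          this, hif, hlt]
        omega
      · have : s.lev - d[j] = 0 := by omega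
        simp [Prog.run, Prog.block, State.reg_setReg, State.mem_setReg, h28, h2, hm, h16, h29, hval,
          this, hif, hlt]
        omega
    · exact ⟨h₁.1, le_rfl, by simp [← hd, h₁.2.1], h₁.2.2⟩
    · rintro σ' ⟨-, -, h, -⟩
      simpa using h
  refine (key.frame.frame_mem rfl).mono le_rfl ?_
  rintro σ' ⟨⟨h1, h2⟩, h3⟩
  have h4 : ∀ x < 19, σ'.reg x = σ.reg x := fun x hx =>
    h2 x (Prog.keeps_of_writesGE hx (by decide))
  exact ⟨h1, h.congr (b := 0) h4 (h3 ▸ h.table) (h3 ▸ Grows.refl _ _ _ _), h3, h4⟩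

/-- The postcondition of the programs for the steps from `s`. -/
structure After (n K : ℕ) (d : List ℕ) (s : Conf) (σ σ' : State) : Prop where
  cur : Cur n K d s σ'
  grows : Grows n K (addr n K s) σ.mem σ'.mem
  reg : ∀ x < 19, σ'.reg x = σ.reg x

theorem After.refl (h : Cur n K d s σ) : After n K d s σ σ :=
  ⟨h, Grows.refl _ _ _ _, fun _ _ => rfl⟩

theorem After.trans {σ' σ'' : State} (h : After n K d s σ σ') (h' : After n K d s σ' σ'') :
    After n K d s σ σ'' :=
  ⟨h'.cur, h.grows.trans h'.grows, fun x hx => (h'.reg x hx).trans (h.reg x hx)⟩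

/-- Preparing the registers for `markProg` and running it. -/
theorem tri_prepare_mark {l : List Prog} (h : Cur n K d s σ) (hs : Step n K d mv s s')
    (hl : (Prog.block l).loopFree = true) (hw : (Prog.block l).writesGE 19 = true)
    (hst : (Prog.block l).storeFree = true)
    (h' : let σ₁ := (Prog.block l).run σ
      σ₁.reg 20 = addr n K s' ∧ σ₁.reg 21 = s'.done + s'.pend.card ∧
      σ₁.reg 22 = s'.lev ∧ σ₁.reg 23 = s'.done ∧
      σ₁.reg 24 = 8 * levelCode n K s'.lev s'.pend ∧ σ₁.reg 25 = mv) :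
    Tri (.seq (.block l) markProg) σ ((Prog.block l).cost + 14) fun σ' =>
      After n K d s σ σ' ∧ σ'.mem (addr n K s') ≠ 0 ∧
        ((Prog.block l).keeps 28 = true → σ'.reg 28 = σ.reg 28) ∧
        ∀ x < 26, (Prog.block l).keeps x = true → σ'.reg x = σ.reg x := by
  refine Tri.seq ((Tri.of_loopFree (Q := fun σ₁ => σ₁.reg 20 = addr n K s' ∧
      σ₁.reg 21 = s'.done + s'.pend.card ∧ σ₁.reg 22 = s'.lev ∧ σ₁.reg 23 = s'.done ∧
      σ₁.reg 24 = 8 * levelCode n K s'.lev s'.pend ∧ σ₁.reg 25 = mv) hl h').frame.frame_mem hst) ?_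
  rintro σ₁ ⟨⟨⟨h20, h21, h22, h23, h24, h25⟩, hr⟩, hm⟩
  have h4 : ∀ x < 19, σ₁.reg x = σ.reg x := fun x hx =>
    hr x (Prog.keeps_of_writesGE hx hw)
  have hc : Cur n K d s σ₁ := h.congr (b := 0) h4 (hm ▸ h.table) (hm ▸ Grows.refl _ _ _ _)
  refine (tri_markProg hc hs h20 h21 h22 h23 h24 h25).mono le_rfl ?_
  rintro σ' ⟨h1, h2, h3, h5, h6⟩
  exact ⟨⟨h1, hm ▸ h2, fun x hx => (h3 x (by omega)).trans (h4 x hx)⟩, h6,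
    fun hk => h5.trans (hr _ hk), fun x hx hk => (h3 x hx).trans (hr x hk)⟩

/-- Perform the step that turns a pending node of the current level into a leaf. -/
def leafProg : Prog :=
  .seq countProg (.seq (.sub 27 29 17) (.branch 27 .skip (.seq (.block [
    .sub 20 14 6, .sub 20 20 5, .copy 21 15, .copy 22 16, .add 23 17 2, .sub 24 18 5,
    .add 25 3 2]) markProg)))

theorem tri_leafProg {l i : ℕ} {M : Multiset ℕ} (h : Cur n K d ⟨l, i, l ::ₘ M⟩ σ)
    (hd : d.length = n) :
    Tri leafProg σ (n * 7 + 28) fun σ' => After n K d ⟨l, i, l ::ₘ M⟩ σ σ' ∧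
      ((d : Multiset ℕ).countP (· < l) ≤ i → σ'.mem (addr n K ⟨l, i + 1, M⟩) ≠ 0) := by
  refine Tri.mono (T := (n * 7 + 4) + (1 + (1 + 22))) (Q := fun σ' =>
    After n K d ⟨l, i, l ::ₘ M⟩ σ σ' ∧ ((d : Multiset ℕ).countP (· < l) ≤ i →
      σ'.mem (addr n K ⟨l, i + 1, M⟩) ≠ 0)) ?_ (by omega) fun _ h => h
  refine (tri_countProg h hd).seq ?_
  rintro σ₁ ⟨h29, hc, hm, hr⟩
  have ha : After n K d ⟨l, i, l ::ₘ M⟩ σ σ₁ := ⟨hc, hm ▸ Grows.refl _ _ _ _, hr⟩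
  refine Tri.seq ((Tri.of_loopFree (Q := fun σ' => σ'.reg 27 = (d : Multiset ℕ).countP (· < l) - i)
    rfl ?_).frame.frame_mem rfl) ?_
  · simp [Prog.run, State.reg_setReg, h29, hc.r17]
  rintro σ₂ ⟨⟨h27, hr2⟩, hm2⟩
  have hr2' : ∀ x < 19, σ₂.reg x = σ₁.reg x := fun x hx =>
    hr2 x (Prog.keeps_of_writesGE hx (by decide))
  have hc2 : Cur n K d ⟨l, i, l ::ₘ M⟩ σ₂ :=
    hc.congr (b := 0) hr2' (hm2 ▸ hc.table) (hm2 ▸ Grows.refl _ _ _ _)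
  have ha2 : After n K d ⟨l, i, l ::ₘ M⟩ σ σ₂ :=
    ha.trans ⟨hc2, hm2 ▸ Grows.refl _ _ _ _, hr2'⟩
  refine Tri.branch ?_ ?_
  · intro h0
    refine Tri.mono (Tri.of_loopFree rfl (Q := fun σ' => σ' = σ₂) rfl) (by decide) ?_
    rintro _ rfl
    exact ⟨ha2, fun hle => by omega⟩
  · intro h0
    have hD : (d : Multiset ℕ).countP (· < l) ≤ i := by omega
    obtain ⟨j, hch⟩ := hc2.chain
    have hA := addr_leaf hch.toRec.valid
    refine Tri.mono (tri_prepare_mark hc2 (Step.leaf hD) rfl (by decide) rfl ?_) (by decide) ?_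
    · simp [Prog.run, Prog.block, State.reg_setReg, hc2.r14, hc2.r15, hc2.r16, hc2.r17, hc2.r18,
        hc2.env.r2, hc2.env.r3, hc2.env.r5, hc2.env.r6, levelCode_cons_self]
      refine ⟨?_, ?_, ?_⟩ <;> omega
    · rintro σ' ⟨h1, h2, -⟩
      exact ⟨ha2.trans h1, fun _ => h2⟩

/-- Perform the steps that turn a pending node of the current level into an inner node. -/
def splitProg : Prog :=
  .seq (.block [.sub 19 0 15, .copy 28 3, .add 21 15 2, .copy 22 16, .copy 23 17])
    (.branch 19 (.loop 28 (.seq (.seq (.block [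
      .sub 26 9 28, .load 27 26, .add 26 0 28, .sub 26 26 2, .load 29 26, .add 29 29 27,
      .sub 20 14 5, .add 20 20 29, .sub 24 18 5, .add 24 24 29, .copy 25 28]) markProg)
      (.sub 28 28 2))) .skip)

/-- The loop runs through `a` from `K` down to `1`. The change of address and code is a sum of two
stored powers minus the leading one, so no multiplication is needed. -/
theorem tri_splitProg {l i : ℕ} {M : Multiset ℕ} (h : Cur n K d ⟨l, i, l ::ₘ M⟩ σ) :
    Tri splitProg σ (K * 28 + 8) fun σ' => After n K d ⟨l, i, l ::ₘ M⟩ σ σ' ∧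
      (i + M.card + 1 < n → ∀ a, 1 ≤ a → a ≤ K →
        σ'.mem (addr n K ⟨l, i, (l + a) ::ₘ (l + (K + 1 - a)) ::ₘ M⟩) ≠ 0) := by
  refine Tri.mono (T := 6 + (1 + (K * (27 + 1) + 1))) (Q := fun σ' =>
    After n K d ⟨l, i, l ::ₘ M⟩ σ σ' ∧ (i + M.card + 1 < n → ∀ a, 1 ≤ a → a ≤ K →
        σ'.mem (addr n K ⟨l, i, (l + a) ::ₘ (l + (K + 1 - a)) ::ₘ M⟩) ≠ 0))
    ?_ (by omega) fun _ h => h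
  refine Tri.seq ((Tri.of_loopFree (Q := fun σ' => σ'.reg 19 = n - (i + M.card + 1) ∧
    σ'.reg 28 = K ∧ σ'.reg 21 = i + M.card + 2 ∧ σ'.reg 22 = l ∧ σ'.reg 23 = i)
    rfl ?_).frame.frame_mem rfl) ?_
  · simp [Prog.run, Prog.block, State.reg_setReg, h.r15, h.r16, h.r17, h.env.r0, h.env.r2,
      h.env.r3, add_assoc]
  rintro σ₁ ⟨⟨⟨h19, h28, h21, h22, h23⟩, hr⟩, hm⟩
  have hr' : ∀ x < 19, σ₁.reg x = σ.reg x := fun x hx =>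
    hr x (Prog.keeps_of_writesGE hx (by decide))
  have hc : Cur n K d ⟨l, i, l ::ₘ M⟩ σ₁ :=
    h.congr (b := 0) hr' (hm ▸ h.table) (hm ▸ Grows.refl _ _ _ _)
  have ha : After n K d ⟨l, i, l ::ₘ M⟩ σ σ₁ := ⟨hc, hm ▸ Grows.refl _ _ _ _, hr'⟩
  refine Tri.branch ?_ ?_
  · intro h0
    have hn : i + M.card + 1 < n := by omega
    refine Tri.mono (Tri.loop (I := fun j σ' => j ≤ K ∧ After n K d ⟨l, i, l ::ₘ M⟩ σ σ' ∧
      σ'.reg 28 = j ∧ σ'.reg 21 = i + M.card + 2 ∧ σ'.reg 22 = l ∧ σ'.reg 23 = i ∧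
      ∀ a, j < a → a ≤ K →
        σ'.mem (addr n K ⟨l, i, (l + a) ::ₘ (l + (K + 1 - a)) ::ₘ M⟩) ≠ 0) ?_ ?_ K σ₁ ?_) le_rfl ?_
    · exact fun σ' h => h.2.2.1
    · rintro j σ₂ ⟨hj, ha2, h28, h21, h22, h23, hall⟩
      refine ⟨by omega, ?_⟩
      have hc2 := ha2.cur
      refine Tri.mono (T := 26 + 1) (Tri.seq (Tri.mono (tri_prepare_mark hc2
        (Step.split (a := j + 1) (by omega) hj hn) rfl (by decide) rfl ?_) (by decide)
        (fun _ h => h)) ?_) le_rfl (fun _ h => h)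
      · have hA := addr_split (n := n) (K := K) (l := l) (i := i) (M := M) (a := j + 1)
          (by omega) hj
        have hC := levelCode_split (n := n) (K := K) (l := l) (M := M) (a := j + 1) (by omega) hj
        have e1 : n + K - (j + 1) = n + (K - (j + 1)) := by omega
        have e2 : n + (j + 1) - 1 = n + j := by omega
        have m1 := hc2.table.pow (K - (j + 1)) (by omega)
        have m2 := hc2.table.pow j (by omega)
        -- The address contains the leading power of the pending node at `l`, so the machine's
        -- subtraction does not truncate.
        have hle : 8 * (n + 2) ^ K ≤ addr n K ⟨l, i, l ::ₘ M⟩ := by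
          simp only [addr, levelCode_cons_self]
          omega
        simp only [Nat.add_sub_cancel] at hA hC
        simp only [Prog.run, Prog.block, State.reg_setReg, State.mem_setReg, hc2.r14, hc2.r18,
          hc2.env.r0, hc2.env.r9, hc2.env.r2, hc2.env.r5, levelCode_cons_self, h28, h21, h22, h23,
          reduceIte, Nat.reduceEqDiff, e1, e2, m1, m2, Multiset.card_cons, hC, and_true, true_and]
        refine ⟨?_, ?_, ?_⟩ <;> omega
      · rintro σ₃ ⟨ha3, hne, h28', hrest⟩
        refine Tri.of_loopFree rfl ⟨by omega, ?_, ?_, ?_, ?_, ?_, ?_⟩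
        · refine ha2.trans (ha3.trans ⟨?_, Grows.refl _ _ _ _, ?_⟩)
          · exact ha3.cur.congr (b := 0) (fun x hx => by simp [Prog.run, State.reg_setReg]; omega)
              ha3.cur.table (Grows.refl _ _ _ _)
          · exact fun x hx => by simp [Prog.run, State.reg_setReg]; omega
        · have h2 := ha3.cur.env.r2
          simp [Prog.run, State.reg_setReg, h2, h28' rfl, h28]
        · simp [Prog.run, State.reg_setReg, hrest 21 (by omega) rfl, h21]
        · simp [Prog.run, State.reg_setReg, hrest 22 (by omega) rfl, h22]
        · simp [Prog.run, State.reg_setReg, hrest 23 (by omega) rfl, h23]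
        · intro a ha haK
          simp only [Prog.run, State.mem_setReg]
          by_cases hja : a = j + 1
          · rw [hja]; exact hne
          · exact ha3.grows.marked (hall a (by omega) haK)
    · exact ⟨le_rfl, ha, h28, h21, h22, h23, fun a h1 h2 => by omega⟩
    · rintro σ' ⟨-, h1, -, -, -, -, h2⟩
      exact ⟨h1, fun _ a ha => h2 a (by omega)⟩
  · intro h0
    refine Tri.mono (Tri.of_loopFree rfl (Q := fun σ' => σ' = σ₁) rfl)
      (by simp only [Prog.cost]; omega) ?_
    rintro _ rfl
    exact ⟨ha, fun hle => by omega⟩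

/-- Perform the step to the next level. -/
def shiftProg : Prog :=
  .seq (.sub 19 8 16) (.branch 19 (.seq (.mul 24 18 4 28) (.seq (.block [
    .sub 20 14 7, .sub 20 20 18, .add 20 20 24, .copy 21 15, .add 22 16 2, .copy 23 17,
    .const 25 0]) markProg)) .skip)

theorem tri_shiftProg {l i : ℕ} {M : Multiset ℕ} (h : Cur n K d ⟨l, i, M⟩ σ) (hl : l ∉ M)
    (hi : i < n) :
    Tri shiftProg σ (n * 3 + 40) fun σ' => After n K d ⟨l, i, M⟩ σ σ' ∧
      (l < K * n → σ'.mem (addr n K ⟨l + 1, i, M⟩) ≠ 0) := by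
  refine Tri.mono (T := 1 + (1 + ((3 * (n + 2) + 3) + 22))) (Q := fun σ' =>
    After n K d ⟨l, i, M⟩ σ σ' ∧ (l < K * n → σ'.mem (addr n K ⟨l + 1, i, M⟩) ≠ 0))
    ?_ (by omega) fun _ h => h
  refine Tri.seq ((Tri.of_loopFree (Q := fun σ' => σ'.reg 19 = K * n - l)
    rfl ?_).frame.frame_mem rfl) ?_
  · simp [Prog.run, State.reg_setReg, h.r16, h.env.r8]
  rintro σ₁ ⟨⟨h19, hr⟩, hm⟩
  have hr' : ∀ x < 19, σ₁.reg x = σ.reg x := fun x hx =>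
    hr x (Prog.keeps_of_writesGE hx (by decide))
  have hc : Cur n K d ⟨l, i, M⟩ σ₁ :=
    h.congr (b := 0) hr' (hm ▸ h.table) (hm ▸ Grows.refl _ _ _ _)
  have ha : After n K d ⟨l, i, M⟩ σ σ₁ := ⟨hc, hm ▸ Grows.refl _ _ _ _, hr'⟩
  refine Tri.branch ?_ ?_
  · intro h0
    have hlK : l < K * n := by omega
    have hmul := Tri.mul 24 18 4 28 hc.env.r2 (by omega) (by omega) (by omega) (by omega)
      (by omega) (by omega)
    rw [hc.env.r4] at hmul
    refine Tri.seq hmul ?_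
    rintro σ₂ ⟨h24, hm2, hr2⟩
    have hr2' : ∀ x < 19, σ₂.reg x = σ₁.reg x := fun x hx => hr2 x (by omega) (by omega)
    have hc2 : Cur n K d ⟨l, i, M⟩ σ₂ :=
      hc.congr (b := 0) hr2' (hm2 ▸ hc.table) (hm2 ▸ Grows.refl _ _ _ _)
    have ha2 : After n K d ⟨l, i, M⟩ σ σ₂ := ha.trans ⟨hc2, hm2 ▸ Grows.refl _ _ _ _, hr2'⟩
    obtain ⟨j, hch⟩ := hc2.chain
    have hv := hch.toRec.valid
    refine Tri.mono (tri_prepare_mark hc2 (Step.shift hl hi hlK) rfl (by decide) rfl ?_)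
      (by decide) ?_
    · have hA := addr_shift hv hlK
      -- Since `l < K * n`, the address contains a full block for one level besides the code, so
      -- both subtractions are exact.
      have hle : row n K * (n + 1) + 8 * levelCode n K l M ≤ addr n K ⟨l, i, M⟩ := by
        have : row n K * (n + 1) * 1 ≤ row n K * (n + 1) * (K * n - l) :=
          Nat.mul_le_mul_left _ (by omega)
        simp only [addr]
        omega
      rw [hc.r18] at h24
      simp only [Prog.run, Prog.block, State.reg_setReg, hc2.r14, hc2.r15, hc2.r16, hc2.r17,
        hc2.r18, hc2.env.r2, hc2.env.r7, h24, reduceIte, Nat.reduceEqDiff,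
        levelCode_succ_left hv.pend_le, and_true, mul_assoc] at hA ⊢
      omega
    · rintro σ' ⟨h1, h2, -⟩
      exact ⟨ha2.trans h1, fun _ => h2⟩
  · intro h0
    refine Tri.mono (Tri.of_loopFree rfl (Q := fun σ' => σ' = σ₁) rfl)
      (by simp only [Prog.cost]; omega) ?_
    rintro _ rfl
    exact ⟨ha, fun hle => by omega⟩

end Conf

/-! ### The sweep over the table -/

namespace Conf

variable {n K b j mv : ℕ} {d : List ℕ} {s s' : Conf} {σ : State} {D : Multiset ℕ} {m m' : ℕ → ℕ}

theorem Step.inv (h : Step n K D mv s s') :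
    (s.lev ∉ s.pend ∧ s.lev < K * n ∧ s' = ⟨s.lev + 1, s.done, s.pend⟩) ∨
      ∃ M, s.pend = s.lev ::ₘ M ∧ ((D.countP (· < s.lev) ≤ s.done ∧ s' = ⟨s.lev, s.done + 1, M⟩) ∨
        ∃ a, 1 ≤ a ∧ a ≤ K ∧ s.done + M.card + 1 < n ∧
          s' = ⟨s.lev, s.done, (s.lev + a) ::ₘ (s.lev + (K + 1 - a)) ::ₘ M⟩) := by
  cases h with
  | shift hM hi hl => exact .inl ⟨hM, hl, rfl⟩
  | @leaf _ _ M hD => exact .inr ⟨M, rfl, .inl ⟨hD, rfl⟩⟩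
  | @split _ _ _ M ha haK hn => exact .inr ⟨M, rfl, .inr ⟨_, ha, haK, hn, rfl⟩⟩

theorem Step.done_ne (h : Step n K D mv s s') (hs : s.Valid n K) : s.done ≠ n := by
  have := hs.card_le
  cases h with
  | shift hM hi hl => exact hi.ne
  | _ =>
    simp only [Multiset.card_cons] at *
    omega

/-- All configurations that can be reached from `s` in one step have a record. -/
def Closed (n K : ℕ) (D : Multiset ℕ) (m : ℕ → ℕ) (s : Conf) : Prop :=
  ∀ mv s', Step n K D mv s s' → m (addr n K s') ≠ 0

theorem Closed.grows (h : Closed n K D m s) (hg : Grows n K b m m') : Closed n K D m' s :=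
  fun mv s' hs => hg.marked (h mv s' hs)

/-- Process the record at the address in register 14. -/
def expandProg : Prog :=
  .seq (.block [.add 26 14 2, .load 16 26, .add 26 26 2, .load 17 26, .add 26 26 2, .load 18 26,
    .sub 19 0 17, .add 20 18 2, .sub 20 20 5])
    (.branch 19 (.branch 20 (.seq leafProg splitProg) shiftProg) (.copy 12 14))

theorem tri_expandProg (he : Env n K σ.reg) (ht : Table n K d σ.mem) (hc : Chain n K d σ.mem j s)
    (h14 : σ.reg 14 = addr n K s) (h15 : σ.reg 15 = s.done + s.pend.card) (hd : d.length = n) :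
    Tri expandProg σ (n * 7 + K * 28 + 52) fun σ' => Env n K σ'.reg ∧ Table n K d σ'.mem ∧
      Grows n K (addr n K s) σ.mem σ'.mem ∧ σ'.reg 13 = σ.reg 13 ∧
      ((s.done = n ∧ σ'.reg 12 = addr n K s) ∨
        (s.done ≠ n ∧ σ'.reg 12 = σ.reg 12 ∧ Closed n K d σ'.mem s)) := by
  have hv := hc.toRec.valid
  refine Tri.mono (T := 10 + (1 + (1 + (n * 7 + K * 28 + 40)))) (Q := fun σ' =>
    Env n K σ'.reg ∧ Table n K d σ'.mem ∧
      Grows n K (addr n K s) σ.mem σ'.mem ∧ σ'.reg 13 = σ.reg 13 ∧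
      ((s.done = n ∧ σ'.reg 12 = addr n K s) ∨
        (s.done ≠ n ∧ σ'.reg 12 = σ.reg 12 ∧ Closed n K d σ'.mem s))) ?_ (by omega) fun _ h => h
  -- Adding one before the truncated subtraction makes register 20 nonzero also when the code equals
  -- the leading power.
  refine Tri.seq ((Tri.of_loopFree (Q := fun σ' => σ'.reg 16 = s.lev ∧ σ'.reg 17 = s.done ∧
    σ'.reg 18 = 8 * levelCode n K s.lev s.pend ∧ σ'.reg 19 = n - s.done ∧
    σ'.reg 20 = 8 * levelCode n K s.lev s.pend + 1 - 8 * (n + 2) ^ K)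
    rfl ?_).frame.frame_mem rfl) ?_
  · simp [Prog.run, Prog.block, State.reg_setReg, State.mem_setReg, h14, he.r0, he.r2, he.r5,
      add_assoc, hc.toRec.lev, hc.toRec.done, hc.toRec.code]
  rintro σ₁ ⟨⟨⟨h16, h17, h18, h19, h20⟩, hr⟩, hm⟩
  have hcur : Cur n K d s σ₁ :=
    ⟨he.congr fun x hx => hr x (Prog.keeps_of_writesGE hx (by decide)), hm ▸ ht, ⟨j, hm ▸ hc⟩,
      (hr 14 (by decide)).trans h14, (hr 15 (by decide)).trans h15, h16, h17, h18⟩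
  have hafter : ∀ σ', After n K d s σ₁ σ' → s.done ≠ n → Closed n K d σ'.mem s →
      Env n K σ'.reg ∧ Table n K d σ'.mem ∧
      Grows n K (addr n K s) σ.mem σ'.mem ∧ σ'.reg 13 = σ.reg 13 ∧
      ((s.done = n ∧ σ'.reg 12 = addr n K s) ∨
        (s.done ≠ n ∧ σ'.reg 12 = σ.reg 12 ∧ Closed n K d σ'.mem s)) := by
    intro σ' h h1 h2
    exact ⟨h.cur.env, h.cur.table, hm ▸ h.grows, (h.reg 13 (by omega)).trans (hr 13 (by decide)),
      .inr ⟨h1, (h.reg 12 (by omega)).trans (hr 12 (by decide)), h2⟩⟩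
  have hpow := pow_le_levelCode_iff hv.le_pend hv.pend_le hv.card_pend_le
  have hcard := hv.card_le
  refine Tri.branch (fun h0 => Tri.branch (fun h1 => ?_) fun h1 => ?_) fun h0 => ?_
  · have hmem : s.lev ∈ s.pend := hpow.1 (by omega)
    obtain ⟨M, hM⟩ := Multiset.exists_cons_of_mem hmem
    obtain ⟨l, i, P⟩ := s
    simp only at hM
    subst hM
    refine Tri.mono (Tri.seq (tri_leafProg hcur hd) (T' := K * 28 + 8) (R := fun σ' =>
      After n K d ⟨l, i, l ::ₘ M⟩ σ₁ σ' ∧ Closed n K d σ'.mem ⟨l, i, l ::ₘ M⟩) ?_) (by omega)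
      (fun σ' h => hafter σ' h.1 (by simp only at *; omega) h.2)
    rintro σ₂ ⟨ha2, hleaf⟩
    refine (tri_splitProg ha2.cur).mono le_rfl ?_
    rintro σ₃ ⟨ha3, hsplit⟩
    refine ⟨ha2.trans ha3, fun mv s' hs => ?_⟩
    rcases hs.inv with h | ⟨M', hM', h⟩
    · exact absurd hmem h.1
    · simp only [Multiset.cons_inj_right] at hM'
      subst hM'
      rcases h with ⟨hD, rfl⟩ | ⟨a, h1, h2, h3, rfl⟩
      · exact ha3.grows.marked (hleaf hD)
      · exact hsplit h3 a h1 h2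
  · have hmem : s.lev ∉ s.pend := fun h => by
      have := hpow.2 h
      omega
    have hlt : s.done < n := by omega
    refine Tri.mono (tri_shiftProg (l := s.lev) (i := s.done) (M := s.pend) hcur hmem hlt)
      (by omega) ?_
    rintro σ' ⟨ha, hshift⟩
    refine hafter σ' ha hlt.ne fun mv s' hs => ?_
    rcases hs.inv with ⟨-, h, rfl⟩ | ⟨M', hM', -⟩
    · exact hshift h
    · exact absurd (hM' ▸ Multiset.mem_cons_self _ _) hmem
  · refine Tri.mono (Tri.of_loopFree rfl (Q := fun σ' => σ' = σ₁.setReg 12 (σ₁.reg 14)) rfl)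
      (by simp only [Prog.cost]; omega) ?_
    rintro _ rfl
    refine ⟨hcur.env.congr fun x hx => ?_, hcur.table, ?_, ?_, .inl ⟨by omega, ?_⟩⟩
    · rw [State.reg_setReg, if_neg (by omega)]
    · rw [State.mem_setReg, hm]; exact Grows.refl _ _ _ _
    · simp [State.reg_setReg, hr 13 (by decide)]
    · simp [State.reg_setReg, hcur.r14]

/-- The invariant of the sweep over the table from high to low addresses: the records from
`n + K + 8 * j` on have been processed. -/
structure Swept (n K : ℕ) (d : List ℕ) (j : ℕ) (σ : State) : Prop where
  env : Env n K σ.reg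
  table : Table n K d σ.mem
  r13 : σ.reg 13 = 8 * j
  closed : ∀ i s, Chain n K d σ.mem i s → n + K + 8 * j ≤ addr n K s →
    (s.done = n → σ.reg 12 ≠ 0) ∧ (s.done ≠ n → Closed n K d σ.mem s)
  fin : σ.reg 12 ≠ 0 → ∃ i s, Chain n K d σ.mem i s ∧ s.done = n ∧ σ.reg 12 = addr n K s

/-- Process all records of the table. -/
def sweepProg : Prog :=
  .loop 13 (.seq (.block [.sub 13 13 11, .add 14 9 13, .load 15 14]) (.branch 15 expandProg .skip))

/-- Processing a record creates only records at lower addresses, so what has been swept stays closed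
under steps. -/
theorem tri_sweepProg (h : Swept n K d j σ) (hd : d.length = n) (hn : 1 ≤ n) :
    Tri sweepProg σ (j * (n * 7 + K * 28 + 58) + 1) (Swept n K d 0) := by
  refine Tri.mono (Tri.loop (T := 4 + (1 + (n * 7 + K * 28 + 52))) (I := Swept n K d) ?_ ?_ j σ h)
    (by rw [show 4 + (1 + (n * 7 + K * 28 + 52)) + 1 = n * 7 + K * 28 + 58 by omega]) fun _ h => h
  · intro σ h
    rw [h.r13]
  rintro j σ ⟨he, ht, h13, hcl, hfin⟩
  refine ⟨by omega, ?_⟩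
  refine Tri.seq ((Tri.of_loopFree (Q := fun σ' => σ'.reg 13 = 8 * j ∧
    σ'.reg 14 = n + K + 8 * j ∧ σ'.reg 15 = σ.mem (n + K + 8 * j)) rfl ?_).frame.frame_mem rfl) ?_
  · simp [Prog.run, Prog.block, State.reg_setReg, State.mem_setReg, h13, he.r9, he.r11, mul_add]
  rintro σ₁ ⟨⟨⟨h13', h14, h15⟩, hr⟩, hm⟩
  have he₁ : Env n K σ₁.reg := he.congr fun x hx => hr x (Prog.keeps_of_writesGE hx (by decide))
  have h12 : σ₁.reg 12 = σ.reg 12 := hr 12 (by decide)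
  have hbound : ∀ s : Conf, n + K + 8 * j ≤ addr n K s → addr n K s ≠ n + K + 8 * j →
      n + K + 8 * (j + 1) ≤ addr n K s := by
    intro s h1 h2
    obtain ⟨x, hx⟩ := exists_addr_eq (n := n) (K := K) s
    omega
  refine Tri.branch ?_ ?_
  · intro h0
    obtain ⟨i, s, hc, hs⟩ := ht.chain j (h15 ▸ h0)
    refine (tri_expandProg he₁ (hm ▸ ht) (hm ▸ hc) (h14.trans hs.symm) ?_ hd).mono le_rfl ?_
    · rw [h15, ← hs, hc.toRec.mark]
    rintro σ₂ ⟨h1, h2, h3, h4, h5⟩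
    rw [hm] at h3
    have hcase : σ.reg 12 ≠ 0 → σ₂.reg 12 ≠ 0 := by
      intro h
      rcases h5 with ⟨-, h5⟩ | ⟨-, h5, -⟩
      · omega
      · rwa [h5, h12]
    refine ⟨h1, h2, h4.trans h13', fun i' s' hc' hs' => ?_, fun hne => ?_⟩
    -- A record at or above the current address already existed before this pass; injectivity of
    -- addresses identifies its configuration.
    · obtain ⟨x, hx⟩ := exists_addr_eq (n := n) (K := K) s'
      have hmk := hc'.toRec.mark_ne_zero
      rw [hx, h3.mark x (by omega)] at hmk
      obtain ⟨i'', s'', hc'', hs''⟩ := ht.chain x hmk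
      obtain rfl : s'' = s' :=
        addr_injective hc''.toRec.valid hc'.toRec.valid (hs''.trans hx.symm)
      by_cases heq : addr n K s'' = n + K + 8 * j
      · obtain rfl : s = s'' :=
          addr_injective hc.toRec.valid hc''.toRec.valid (hs.trans heq.symm)
        rcases h5 with ⟨h5, h6⟩ | ⟨h5, h6, h7⟩
        · exact ⟨fun _ => by omega, fun h => absurd h5 h⟩
        · exact ⟨fun h => absurd h h5, fun _ => h7⟩
      · have := hcl _ _ hc'' (hbound _ hs' heq)
        exact ⟨fun h => hcase (this.1 h), fun h => (this.2 h).grows h3⟩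
    · rcases h5 with ⟨h5, h6⟩ | ⟨h5, h6, h7⟩
      · exact ⟨i, s, hc.grows h3, h5, h6⟩
      · rw [h6, h12] at hne ⊢
        obtain ⟨i, s, h⟩ := hfin hne
        exact ⟨i, s, h.1.grows h3, h.2⟩
  · intro h0
    refine Tri.mono (Tri.of_loopFree rfl (Q := fun σ' => σ' = σ₁) rfl)
      (by simp only [Prog.cost]; omega) ?_
    rintro _ rfl
    refine ⟨he₁, hm ▸ ht, h13', fun i' s' hc' hs' => ?_, ?_⟩
    · rw [hm] at hc' ⊢
      rw [h12]
      refine hcl _ _ hc' (hbound _ hs' fun heq => hc'.toRec.mark_ne_zero ?_)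
      rw [heq, ← h15, h0]
    · rw [h12, hm]
      exact hfin

/-- After the full sweep the marked configurations contain the start and are closed under steps,
since a configuration that admits a step is not final. -/
theorem Swept.chain_of_reachable (h : Swept n K d 0 σ) (hn : 1 ≤ n)
    (hs : Relation.ReflTransGen (fun s s' => ∃ mv, Step n K (d : Multiset ℕ) mv s s') start s) :
    ∃ i, Chain n K d σ.mem i s := by
  have key : ∀ {s : Conf}, s.Valid n K → σ.mem (addr n K s) ≠ 0 → ∃ i, Chain n K d σ.mem i s := by
    intro s hv hs
    obtain ⟨x, hx⟩ := exists_addr_eq (n := n) (K := K) s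
    rw [hx] at hs
    obtain ⟨i, s', hc, hs'⟩ := h.table.chain x hs
    obtain rfl : s' = s := addr_injective hc.toRec.valid hv (hs'.trans hx.symm)
    exact ⟨i, hc⟩
  induction hs with
  | refl => exact key (valid_start hn) h.table.start
  | tail _ hstep ih =>
    obtain ⟨i, hc⟩ := ih
    obtain ⟨mv, hstep⟩ := hstep
    refine key (hstep.valid hc.toRec.valid) ?_
    refine (h.closed _ _ hc ?_).2 (hstep.done_ne hc.toRec.valid) _ _ hstep
    simp only [addr]
    omega

end Conf

/-! ### Forests in memory as linked lists of trees, one list per level -/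

theorem RAM.Stored.congr {m m' : ℕ → ℕ} {T : LTree} {p : ℕ} {S : Finset ℕ} (h : Stored m T p S)
    (hm : ∀ x ∈ S, m' x = m x) : Stored m' T p S := by
  induction h with
  | leaf hp => exact .leaf (by rw [hm _ (by simp), hp])
  | @node p l r S₁ S₂ hp hl hr h₁₂ h₁ h₂ ihl ihr =>
    have e0 : m' p = m p := hm _ (by simp)
    have e1 : m' (p + 1) = m (p + 1) := hm _ (by simp)
    have e2 : m' (p + 2) = m (p + 2) := hm _ (by simp)
    have e3 : m' (p + 3) = m (p + 3) := hm _ (by simp)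
    rw [← e0, ← e1]
    refine .node (by rwa [e0]) ?_ ?_ h₁₂ h₁ h₂
    · rw [e2]
      exact ihl fun x hx => hm x (by simp [hx])
    · rw [e3]
      exact ihr fun x hx => hm x (by simp [hx])

/-- A linked list of trees; the record at `p` is followed by the one whose address is in the cell
`p + 4`. -/
inductive LinkedTrees (m : ℕ → ℕ) : ℕ → List LTree → Finset ℕ → Prop where
  | nil (p : ℕ) : LinkedTrees m p [] ∅
  | cons {p : ℕ} {T : LTree} {L : List LTree} {S G : Finset ℕ} (hT : Stored m T p S)
      (hp : p + 4 ∉ S) (hL : LinkedTrees m (m (p + 4)) L G) (hd : Disjoint (insert (p + 4) S) G) :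
      LinkedTrees m p (T :: L) (insert (p + 4) S ∪ G)

theorem LinkedTrees.congr {m m' : ℕ → ℕ} {L : List LTree} {p : ℕ} {G : Finset ℕ}
    (h : LinkedTrees m p L G) (hm : ∀ x ∈ G, m' x = m x) : LinkedTrees m' p L G := by
  induction h with
  | nil p => exact .nil p
  | @cons p T L S G hT hp hL hd ih =>
    refine .cons (hT.congr fun x hx => hm x (by simp [hx])) hp ?_ hd
    rw [hm (p + 4) (by simp)]
    exact ih fun x hx => hm x (by simp [hx])

/-- The trees of the forest `Ψ` whose roots have level `l` are stored in a linked list `Φ l` with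
head cell `H + l`, for `l ≤ w`. The cells from `F` on are free, and those in `U` are reserved. -/
structure Heap (H w F : ℕ) (m : ℕ → ℕ) (U : Finset ℕ) (Ψ : Multiset (ℕ × LTree))
    (Φ : ℕ → List LTree) (G : ℕ → Finset ℕ) : Prop where
  list : ∀ l ≤ w, LinkedTrees m (m (H + l)) (Φ l) (G l)
  disj : ∀ l ≤ w, ∀ l' ≤ w, l ≠ l' → Disjoint (G l) (G l')
  range : ∀ l ≤ w, ∀ p ∈ G l, H + w < p ∧ p < F
  held : ∀ l ≤ w, Disjoint U (G l)
  held_range : ∀ p ∈ U, H + w < p ∧ p < F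
  forest : ∀ l ≤ w, (Ψ.filter (·.1 = l)).map Prod.snd = (Φ l : Multiset LTree)
  free : H + w < F

/-- The forest `Ψ` is stored in linked lists. -/
def Holds (H w F : ℕ) (m : ℕ → ℕ) (U : Finset ℕ) (Ψ : Multiset (ℕ × LTree)) : Prop :=
  ∃ Φ G, Heap H w F m U Ψ Φ G

/-- Remove the first record from the list with head cell `h`. -/
def popMem (m : ℕ → ℕ) (h : ℕ) : ℕ → ℕ :=
  Function.update m h (m (m h + 4))

/-- Insert the record at `F` into the list with head cell `h`. -/
def pushMem (m : ℕ → ℕ) (F h : ℕ) : ℕ → ℕ :=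
  Function.update (Function.update m (F + 4) (m h)) h F

/-- Write the record of an inner node at `F`. -/
def nodeMem (m : ℕ → ℕ) (F a b x y : ℕ) : ℕ → ℕ :=
  Function.update (Function.update (Function.update (Function.update m F a) (F + 1) b) (F + 2) x)
    (F + 3) y

section

variable {H w F l : ℕ} {m m' : ℕ → ℕ} {U S : Finset ℕ} {Ψ : Multiset (ℕ × LTree)}

/-- Lists have no end marker, their lengths being fixed by the forest, so empty lists need no
initialization. Free cells start right behind the head cells. -/
theorem holds_zero (H w : ℕ) (m : ℕ → ℕ) : Holds H w (H + w + 1) m ∅ 0 :=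
  ⟨fun _ => [], fun _ => ∅, fun _ _ => .nil _, by simp, by simp, by simp, by simp, by simp,
    by omega⟩

theorem Holds.free (h : Holds H w F m U Ψ) : H + w < F := by
  obtain ⟨Φ, G, h⟩ := h
  exact h.free

theorem Holds.congr (h : Holds H w F m U Ψ) (hm : ∀ p, H ≤ p → p < F → m' p = m p) :
    Holds H w F m' U Ψ := by
  obtain ⟨Φ, G, h₁, h₂, h₃, h₄, h₅, h₆, h₇⟩ := h
  refine ⟨Φ, G, fun l hl => ?_, h₂, h₃, h₄, h₅, h₆, h₇⟩
  rw [hm _ (by omega) (by omega)]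
  refine (h₁ l hl).congr fun x hx => ?_
  have := h₃ l hl x hx
  exact hm _ (by omega) (by omega)

/-- The tree obtained is the one that happens to head the list; trees at one level are
interchangeable. Its cells pass to the reserved set until it is attached to a parent. -/
theorem Holds.pop (h : Holds H w F m U Ψ) (hl : l ≤ w) (hΨ : l ∈ Ψ.map Prod.fst) :
    ∃ T Ψ' S, Ψ = (l, T) ::ₘ Ψ' ∧ Stored (popMem m (H + l)) T (m (H + l)) S ∧
      Disjoint U S ∧ (∀ p ∈ S, H + w < p ∧ p < F) ∧
      Holds H w F (popMem m (H + l)) (U ∪ S) Ψ' := by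
  obtain ⟨Φ, G, h₁, h₂, h₃, h₄, h₅, h₆, h₇⟩ := h
  obtain ⟨⟨l, T₀⟩, hx, rfl⟩ := Multiset.mem_map.1 hΨ
  simp only at hl hΨ ⊢
  have hmem : T₀ ∈ Φ l := by
    rw [← Multiset.mem_coe, ← h₆ l hl, Multiset.mem_map]
    exact ⟨(l, T₀), by simp [hx], rfl⟩
  have hlist := h₁ l hl
  generalize hp : m (H + l) = p at hlist
  generalize hΦ : Φ l = L at hlist hmem
  generalize hG : G l = G₀ at hlist
  cases hlist with
  | nil => simp at hmem
  | @cons _ T L S G₁ hT hp4 hL hd =>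
    have hTΨ : (l, T) ∈ Ψ := by
      have : T ∈ (Ψ.filter (·.1 = l)).map Prod.snd := by rw [h₆ l hl, hΦ]; simp
      obtain ⟨⟨l', T'⟩, hy, rfl⟩ := Multiset.mem_map.1 this
      simp only [Multiset.mem_filter] at hy
      obtain ⟨hy, rfl⟩ := hy
      exact hy
    obtain ⟨Ψ', rfl⟩ := Multiset.exists_cons_of_mem hTΨ
    have hSG : ∀ p ∈ S, p ∈ G l := fun p hp => by rw [hG]; simp [hp]
    have hG₁ : ∀ p ∈ G₁, p ∈ G l := fun p hp => by rw [hG]; simp [hp]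
    have hSG₁ : Disjoint S G₁ := hd.mono_left (Finset.subset_insert _ _)
    have hpop : popMem m (H + l) = Function.update m (H + l) (m (p + 4)) := by rw [popMem, hp]
    have hne : ∀ x, H + w < x → popMem m (H + l) x = m x := fun x hx => by
      rw [hpop, Function.update_of_ne (by omega)]
    refine ⟨T, Ψ', S, rfl, hT.congr fun x hx => hne x (h₃ l hl x (hSG x hx)).1,
      (h₄ l hl).mono_right hSG, fun p hp => h₃ l hl p (hSG p hp),
      Function.update Φ l L, Function.update G l G₁, fun l' hl' => ?_, fun l' hl' l'' hl'' hne => ?_,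
      fun l' hl' => ?_, fun l' hl' => ?_, ?_, fun l' hl' => ?_, h₇⟩
    · by_cases hll : l' = l
      · subst hll
        rw [Function.update_self, Function.update_self]
        rw [show popMem m (H + l') (H + l') = m (p + 4) by rw [hpop, Function.update_self]]
        exact hL.congr fun x hx => hne x (h₃ l' hl x (hG₁ x hx)).1
      · rw [Function.update_of_ne hll, Function.update_of_ne hll]
        rw [show popMem m (H + l) (H + l') = m (H + l') by
          rw [hpop, Function.update_of_ne (by omega)]]
        exact (h₁ l' hl').congr fun x hx => hne x (h₃ l' hl' x hx).1
    · have hsub : ∀ y, Function.update G l G₁ y ⊆ G y := fun l' => by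
        by_cases hll : l' = l
        · subst hll; rw [Function.update_self]; exact hG₁
        · rw [Function.update_of_ne hll]
      exact (h₂ l' hl' l'' hl'' hne).mono (hsub _) (hsub _)
    · by_cases hll : l' = l
      · subst hll
        rw [Function.update_self]
        exact fun p hp => h₃ _ hl' p (hG₁ p hp)
      · rw [Function.update_of_ne hll]
        exact h₃ l' hl'
    · by_cases hll : l' = l
      · subst hll
        rw [Function.update_self, Finset.disjoint_union_left]
        exact ⟨(h₄ _ hl').mono_right hG₁, hSG₁⟩
      · rw [Function.update_of_ne hll, Finset.disjoint_union_left]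
        exact ⟨h₄ l' hl', (h₂ l hl l' hl' (Ne.symm hll)).mono_left hSG⟩
    · intro p hp
      rcases Finset.mem_union.1 hp with hp | hp
      · exact h₅ p hp
      · exact h₃ l hl p (hSG p hp)
    · have h6 := h₆ l' hl'
      by_cases hll : l' = l
      · subst hll
        rw [hΦ, Multiset.filter_cons_of_pos _ (by rfl), Multiset.map_cons, ← Multiset.cons_coe,
          Multiset.cons_inj_right] at h6
        rw [Function.update_self, h6]
      · rw [Multiset.filter_cons_of_neg _ (fun h => hll h.symm)] at h6
        rw [Function.update_of_ne hll, h6]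

/-- The new tree may use the four cells at `F` and the reserved cells only, hence is disjoint from
all lists. The link goes to `F + 4`, and eight cells are consumed. -/
theorem Holds.push {T : LTree} (h : Holds H w F m U Ψ) (hl : l ≤ w) (hT : Stored m T F S)
    (hS : S ⊆ {F, F + 1, F + 2, F + 3} ∪ U) :
    Holds H w (F + 8) (pushMem m F (H + l)) ∅ ((l, T) ::ₘ Ψ) := by
  obtain ⟨Φ, G, h₁, h₂, h₃, h₄, h₅, h₆, h₇⟩ := h
  have hne : ∀ x, H + w < x → x ≠ F + 4 → pushMem m F (H + l) x = m x := fun x hx hx' => by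
    rw [pushMem, Function.update_of_ne (by omega), Function.update_of_ne hx']
  have hSr : ∀ x ∈ S, H + w < x ∧ x < F + 4 := fun x hx => by
    have := hS hx
    simp only [Finset.mem_union, Finset.mem_insert, Finset.mem_singleton] at this
    rcases this with (rfl | rfl | rfl | rfl) | hx
    · omega
    · omega
    · omega
    · omega
    · have := h₅ x hx
      omega
  have hSG : ∀ l ≤ w, Disjoint (insert (F + 4) S) (G l) := fun l hl => by
    rw [Finset.disjoint_left]
    intro x hx hxG
    have hr := h₃ l hl x hxG
    rcases Finset.mem_insert.1 hx with rfl | hx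
    · omega
    · have := hS hx
      simp only [Finset.mem_union, Finset.mem_insert, Finset.mem_singleton] at this
      rcases this with (rfl | rfl | rfl | rfl) | hx
      · omega
      · omega
      · omega
      · omega
      · exact Finset.disjoint_left.1 (h₄ l hl) hx hxG
  refine ⟨Function.update Φ l (T :: Φ l), Function.update G l (insert (F + 4) S ∪ G l),
    fun l' hl' => ?_, fun l' hl' l'' hl'' hll => ?_, fun l' hl' => ?_, by simp, by simp,
    fun l' hl' => ?_, by omega⟩
  · by_cases hll : l' = l
    · subst hll
      rw [Function.update_self, Function.update_self]
      rw [show pushMem m F (H + l') (H + l') = F by rw [pushMem, Function.update_self]]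
      refine .cons (hT.congr fun x hx => ?_) (fun hx => ?_) ?_ (hSG l' hl)
      · have := hSr x hx
        exact hne x (by omega) (by omega)
      · have := hSr _ hx
        omega
      · rw [show pushMem m F (H + l') (F + 4) = m (H + l') by
          rw [pushMem, Function.update_of_ne (by omega), Function.update_self]]
        refine (h₁ l' hl).congr fun x hx => ?_
        have := h₃ l' hl x hx
        exact hne x (by omega) (by omega)
    · rw [Function.update_of_ne hll, Function.update_of_ne hll]
      rw [show pushMem m F (H + l) (H + l') = m (H + l') by
        rw [pushMem, Function.update_of_ne (by omega), Function.update_of_ne (by omega)]]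
      refine (h₁ l' hl').congr fun x hx => ?_
      have := h₃ l' hl' x hx
      exact hne x (by omega) (by omega)
  · by_cases hll' : l' = l
    · subst hll'
      rw [Function.update_self, Function.update_of_ne hll.symm, Finset.disjoint_union_left]
      exact ⟨hSG _ hl'', h₂ _ hl' _ hl'' hll⟩
    · rw [Function.update_of_ne hll']
      by_cases hll'' : l'' = l
      · subst hll''
        rw [Function.update_self, Finset.disjoint_union_right]
        exact ⟨(hSG _ hl').symm, h₂ _ hl' _ hl'' hll⟩
      · rw [Function.update_of_ne hll'']
        exact h₂ _ hl' _ hl'' hll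
  · by_cases hll : l' = l
    · subst hll
      rw [Function.update_self]
      intro p hp
      rcases Finset.mem_union.1 hp with hp | hp
      · rcases Finset.mem_insert.1 hp with rfl | hp
        · omega
        · have := hSr p hp
          omega
      · have := h₃ _ hl p hp
        omega
    · rw [Function.update_of_ne hll]
      intro p hp
      have := h₃ _ hl' p hp
      omega
  · have h6 := h₆ l' hl'
    by_cases hll : l' = l
    · subst hll
      rw [Function.update_self, Multiset.filter_cons_of_pos _ (by rfl), Multiset.map_cons,
        ← Multiset.cons_coe, h6]
    · rw [Function.update_of_ne hll, Multiset.filter_cons_of_neg _ (fun h => hll h.symm), h6]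

theorem Holds.stored_root {T : LTree} (h : Holds H w F m U {(0, T)}) :
    ∃ S, Stored m T (m H) S := by
  obtain ⟨T', Ψ', S, hΨ, hT, -, hS, -⟩ := h.pop (l := 0) (Nat.zero_le _) (by simp)
  have : T' = T := by
    have : (0, T') ∈ ({(0, T)} : Multiset (ℕ × LTree)) := by rw [hΨ]; simp
    simpa using this
  subst this
  refine ⟨S, hT.congr fun x hx => ?_⟩
  have := hS x hx
  rw [popMem, Function.update_of_ne (by omega)]

theorem Holds.leaf (h : Holds H w F m ∅ Ψ) (hl : l ≤ w) :
    Holds H w (F + 8) (pushMem (Function.update m F 0) F (H + l)) ∅ ((l, .leaf) ::ₘ Ψ) := by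
  refine Holds.push (S := {F}) (h.congr fun p _ hp => Function.update_of_ne (by omega) _ _) hl
    (.leaf (by simp)) (by simp)

/-- The second removal acts on the memory left by the first, which covers the case `a = b`, where
both children come from the same list. -/
theorem Holds.node {a b : ℕ} (h : Holds H w F m ∅ Ψ) (ha : a ≠ 0) (hla : l + a ≤ w)
    (hlb : l + b ≤ w) (hΨ : ∃ M, Ψ.map Prod.fst = (l + a) ::ₘ (l + b) ::ₘ M) :
    ∃ T T' Ψ', Ψ = (l + a, T) ::ₘ (l + b, T') ::ₘ Ψ' ∧
      Holds H w (F + 8) (pushMem (nodeMem (popMem (popMem m (H + (l + a))) (H + (l + b))) F a b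
        (m (H + (l + a))) (popMem m (H + (l + a)) (H + (l + b)))) F (H + l)) ∅
        ((l, .node a b T T') ::ₘ Ψ') := by
  obtain ⟨M, hM⟩ := hΨ
  obtain ⟨T, Ψ₁, S₁, rfl, hT, -, hS₁, h₁⟩ := h.pop hla (by simp [hM])
  rw [Multiset.map_cons, Multiset.cons_inj_right] at hM
  obtain ⟨T', Ψ', S₂, rfl, hT', hdisj, hS₂, h₂⟩ := h₁.pop hlb (by simp [hM])
  refine ⟨T, T', Ψ', rfl, ?_⟩
  set m₁ := popMem m (H + (l + a)) with hm₁
  set m₂ := popMem m₁ (H + (l + b)) with hm₂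
  set m₃ := nodeMem m₂ F a b (m (H + (l + a))) (m₁ (H + (l + b))) with hm₃
  have hfree := h.free
  have e0 : m₃ F = a := by simp [hm₃, nodeMem]
  have e1 : m₃ (F + 1) = b := by simp [hm₃, nodeMem]
  have e2 : m₃ (F + 2) = m (H + (l + a)) := by simp [hm₃, nodeMem]
  have e3 : m₃ (F + 3) = m₁ (H + (l + b)) := by simp [hm₃, nodeMem]
  have hlt : ∀ p < F, m₃ p = m₂ p := fun p hp => by
    rw [hm₃, nodeMem]
    repeat rw [Function.update_of_ne (by omega)]
  have hT₂ : Stored m₂ T (m (H + (l + a))) S₁ := hT.congr fun x hx => by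
    have := hS₁ x hx
    rw [hm₂, popMem, Function.update_of_ne (by omega)]
  have hdF : ∀ S : Finset ℕ, (∀ p ∈ S, H + w < p ∧ p < F) →
      Disjoint ({F, F + 1, F + 2, F + 3} : Finset ℕ) S := fun S hS => by
    rw [Finset.disjoint_left]
    intro x hx hxS
    have := hS x hxS
    simp only [Finset.mem_insert, Finset.mem_singleton] at hx
    omega
  have hst : Stored m₃ (.node a b T T') F ({F, F + 1, F + 2, F + 3} ∪ S₁ ∪ S₂) := by
    have := Stored.node (m := m₃) (p := F) (l := T) (r := T') (S₁ := S₁) (S₂ := S₂)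
      (by rw [e0]; exact ha)
      (by rw [e2]; exact hT₂.congr fun x hx => hlt x (hS₁ x hx).2)
      (by rw [e3]; exact hT'.congr fun x hx => hlt x (hS₂ x hx).2)
      (by simpa using hdisj) (hdF _ hS₁) (hdF _ hS₂)
    rwa [e0, e1] at this
  refine Holds.push (h₂.congr fun p _ hp => hlt p hp) (by omega) hst ?_
  simp

end

/-! ### Building the tree by undoing a chain of steps -/

namespace Conf

variable {n k K b j mv F : ℕ} {d : List ℕ} {s s' : Conf} {σ : State} {D : Multiset ℕ}
  {m m' : ℕ → ℕ} {Ψ : Multiset (ℕ × LTree)}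

theorem Valid.addr_add_lt (h : s.Valid n K) {f : ℕ} (hf : f < 8) :
    addr n K s + f < tableEnd n K := by
  have h1 := h.addr_lt
  obtain ⟨x, hx⟩ := exists_addr_eq (n := n) (K := K) s
  have h2 : tableEnd n K = n + K + 8 * ((n + 2) ^ (K + 1) * (n + 1) * (K * n + 1)) := by
    rw [tableEnd, row]
    ring
  omega

theorem Chain.congr_of_lt (h : Chain n K D m j s) (hm : ∀ p < tableEnd n K, m' p = m p) :
    Chain n K D m' j s :=
  h.congr fun _ hs _ hf => hm _ (hs.valid.addr_add_lt hf)

/-- Insert the record at the address in register 13 into the list with head cell in register 17. -/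
def pushProg : Prog :=
  .block [.load 27 17, .const 26 4, .add 26 13 26, .store 26 27, .store 17 13, .add 13 13 11]

/-- Undo the last step to the configuration in register 12, and update the forest. -/
def undoProg : Prog :=
  .branch 16 (.branch 19 (.seq (.block [.const 27 0, .store 13 27]) pushProg)
    (.seq (.block [.add 20 3 2, .sub 20 20 16, .add 21 17 16, .load 22 21, .const 26 4,
      .add 26 22 26, .load 27 26, .store 21 27, .add 21 17 20, .load 23 21, .const 26 4,
      .add 26 23 26, .load 27 26, .store 21 27, .store 13 16, .add 26 13 2, .store 26 20,
      .add 26 26 2, .store 26 22, .add 26 26 2, .store 26 23]) pushProg)) .skip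

/-- The step code alone selects the action: zero is a shift and leaves the forest unchanged, `K + 1`
adds a leaf, and any other value is the edge length `a` of a split, whose two subtrees are joined.
-/
theorem tri_undoProg (he : Env n K σ.reg) (hs : Step n K D mv s s') (hv : s'.Valid n K)
    (hk : K = k - 1) (hc : Completes k n D s' Ψ)
    (hh : Holds (tableEnd n K) (K * n + K) F σ.mem ∅ Ψ) (h13 : σ.reg 13 = F)
    (h16 : σ.reg 16 = mv) (h17 : σ.reg 17 = tableEnd n K + s'.lev) (h19 : σ.reg 19 = mv - K) :
    Tri undoProg σ 40 fun σ' => (∃ Ψ', Completes k n D s Ψ' ∧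
      Holds (tableEnd n K) (K * n + K) (σ'.reg 13) σ'.mem ∅ Ψ') ∧
      (∀ p < tableEnd n K, σ'.mem p = σ.mem p) ∧ (∀ x < 13, σ'.reg x = σ.reg x) ∧
      σ'.reg 14 = σ.reg 14 := by
  have key : Tri undoProg σ undoProg.cost fun σ' => (∃ Ψ', Completes k n D s Ψ' ∧
      Holds (tableEnd n K) (K * n + K) (σ'.reg 13) σ'.mem ∅ Ψ') ∧
      (∀ p < tableEnd n K, σ'.mem p = σ.mem p) := by
    refine Tri.of_loopFree rfl ?_
    have hF := hh.free
    have hlev := hv.lev_le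
    cases hs with
    | shift hM hi hl =>
      simp only [undoProg, Prog.run, h16, reduceIte]
      exact ⟨⟨Ψ, hc.shift, h13 ▸ hh⟩, by simp⟩
    | @leaf l i M hD =>
      have e : (undoProg.run σ).mem =
          pushMem (Function.update σ.mem F 0) F (tableEnd n K + l) ∧
          (undoProg.run σ).reg 13 = F + 8 := by
        simp [undoProg, pushProg, Prog.run, Prog.block, State.reg_setReg, State.mem_setReg,
          State.reg_setMem, State.mem_setMem, h13, h16, h17, h19, he.r11, pushMem]
      rw [e.1, e.2]
      refine ⟨⟨_, hc.leaf hD, hh.leaf (by simp only at hlev; omega)⟩, fun p hp => ?_⟩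
      rw [pushMem]
      repeat rw [Function.update_of_ne (by omega)]
    | @split _ l i M ha haK hn =>
      simp only at hlev
      -- A split has `1 ≤ mv ≤ K`, so `K` is positive and `K + 1 = k` despite the truncation in `K =
      -- k - 1`.
      have hb : K + 1 - mv + mv = k := by omega
      obtain ⟨T, T', Ψ', rfl, hH⟩ := hh.node (l := l) (a := mv) (b := K + 1 - mv) (by omega)
        (by omega) (by omega) ⟨M, hc.map_fst⟩
      have e : (undoProg.run σ).mem =
          pushMem (nodeMem (popMem (popMem σ.mem (tableEnd n K + (l + mv)))
            (tableEnd n K + (l + (K + 1 - mv)))) F mv (K + 1 - mv)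
            (σ.mem (tableEnd n K + (l + mv)))
            (popMem σ.mem (tableEnd n K + (l + mv)) (tableEnd n K + (l + (K + 1 - mv)))))
            F (tableEnd n K + l) ∧ (undoProg.run σ).reg 13 = F + 8 := by
        have h0 : mv ≠ 0 := by omega
        have h1 : mv - K = 0 := by omega
        simp [undoProg, pushProg, Prog.run, Prog.block, State.reg_setReg, State.mem_setReg,
          State.reg_setMem, State.mem_setMem, h13, h16, h17, h19, he.r11, he.r2, he.r3, pushMem,
          nodeMem, popMem, h0, h1, add_assoc]
      rw [e.1, e.2]
      refine ⟨⟨_, hc.split ha (by omega) (by omega), hH⟩, fun p hp => ?_⟩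
      rw [pushMem, nodeMem, popMem, popMem]
      repeat rw [Function.update_of_ne (by omega)]
  refine key.frame.mono (by decide) ?_
  rintro σ' ⟨⟨h1, h2⟩, h3⟩
  exact ⟨h1, h2, fun x hx => h3 x (Prog.keeps_of_writesGE hx (by decide)), h3 14 (by decide)⟩

/-- Build a tree from the chain of records that ends at the address in register 12. -/
def buildProg : Prog :=
  .seq (.block [.add 13 10 8, .add 13 13 3, .add 13 13 2, .const 27 4, .add 26 12 27, .load 14 26])
    (.seq (.loop 14 (.seq (.block [.add 26 12 2, .load 15 26, .const 27 5, .add 26 12 27,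
      .load 16 26, .add 17 10 15, .sub 19 16 3]) (.seq undoProg (.block [.copy 12 14, .const 27 4,
      .add 26 12 27, .load 14 26])))) (.block [.load 1 10, .const 0 1]))

/-- In a final configuration nothing is pending, so the empty forest completes it. Each undone step
keeps a completing forest, and at the start this forest is a single tree at level `0`. -/
theorem tri_buildProg (he : Env n K σ.reg) (hc : Chain n K D σ.mem j s) (hdone : s.done = n)
    (h12 : σ.reg 12 = addr n K s) (hk : K = k - 1) (hD : D.card = n) (hn : 1 ≤ n) :
    Tri buildProg σ (j * 54 + 11) fun σ' => σ'.reg 0 = 1 ∧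
      ∃ T S, T.IsL k ∧ T.Meets D ∧ Stored σ'.mem T (σ'.reg 1) S := by
  refine Tri.mono (T := 7 + ((j * (53 + 1) + 1) + 3)) (Q := fun σ' => σ'.reg 0 = 1 ∧
      ∃ T S, T.IsL k ∧ T.Meets D ∧ Stored σ'.mem T (σ'.reg 1) S) ?_ (by omega) fun _ h => h
  refine Tri.seq ((Tri.of_loopFree (Q := fun σ' => σ'.reg 13 = tableEnd n K + (K * n + K) + 1 ∧
    σ'.reg 14 = σ.mem (addr n K s + 4)) rfl ?_).frame.frame_mem rfl) ?_
  · simp [Prog.run, Prog.block, State.reg_setReg, State.mem_setReg, he.r2, he.r3, he.r8, he.r10,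
      h12, add_assoc]
  rintro σ₁ ⟨⟨⟨h13, h14⟩, hr⟩, hm⟩
  refine Tri.seq (Tri.loop (I := fun j σ' => ∃ s Ψ, Env n K σ'.reg ∧ Chain n K D σ'.mem j s ∧
    σ'.reg 12 = addr n K s ∧ σ'.reg 14 = σ'.mem (addr n K s + 4) ∧ Completes k n D s Ψ ∧
    Holds (tableEnd n K) (K * n + K) (σ'.reg 13) σ'.mem ∅ Ψ) ?_ ?_ j σ₁ ?_) ?_
  · rintro σ' ⟨s, Ψ, -, hc, -, h14, -⟩
    cases hc with
    | start hr hp => rw [h14, hp]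
  · rintro j σ' ⟨s', Ψ, he, hc, h12, h14, hcomp, hh⟩
    cases hc with
    | @step _ mv s _ hc hs hrec hp hmv =>
    have hv := hrec.valid
    -- A predecessor address is at least `n`, hence nonzero; only the start record stores `0`, which
    -- ends the loop.
    refine ⟨by rw [h14, hp, addr]; omega, ?_⟩
    refine Tri.mono (T := 8 + (40 + 5)) (Tri.seq ((Tri.of_loopFree (Q := fun σ₂ =>
      σ₂.reg 16 = mv ∧ σ₂.reg 17 = tableEnd n K + s'.lev ∧ σ₂.reg 19 = mv - K)
      rfl ?_).frame.frame_mem rfl) ?_) le_rfl fun _ h => h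
    · simp [Prog.run, Prog.block, State.reg_setReg, State.mem_setReg, he.r2, he.r3, he.r10,
        h12, hmv, hrec.lev]
    rintro σ₂ ⟨⟨⟨h16, h17, h19⟩, hr₂⟩, hm₂⟩
    have he₂ : Env n K σ₂.reg := he.congr fun x hx =>
      hr₂ x (Prog.keeps_of_writesGE hx (by decide))
    rw [← hm₂, ← hr₂ 13 (by decide)] at hh
    refine Tri.seq (tri_undoProg he₂ hs hv hk hcomp hh rfl h16 h17 h19) ?_
    rintro σ₃ ⟨⟨Ψ', hcomp', hh'⟩, hm₃, hr₃, h14₃⟩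
    have hc₃ : Chain n K D σ₃.mem j s := hc.congr_of_lt fun p hp => by rw [hm₃ p hp, hm₂]
    have h14' : σ₃.reg 14 = addr n K s := by rw [h14₃, hr₂ 14 (by decide), h14, hp]
    have he₃ : Env n K σ₃.reg := he₂.congr fun x hx => hr₃ x (by omega)
    refine Tri.of_loopFree rfl ⟨s, Ψ', he₃.congr fun x hx => ?_, ?_, ?_, ?_, hcomp', ?_⟩
    · simp only [Prog.run, Prog.block, State.reg_setReg]
      repeat rw [if_neg (by omega)]
    · exact hc₃
    · simp [Prog.run, Prog.block, State.reg_setReg, h14']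
    · simp [Prog.run, Prog.block, State.reg_setReg, State.mem_setReg, h14']
    · simpa [Prog.run, Prog.block, State.reg_setReg, State.mem_setReg] using hh'
  · have hv := hc.toRec.valid
    obtain ⟨l, i, M⟩ := s
    simp only at hdone
    subst hdone
    obtain rfl : M = 0 := by
      have := hv.card_le
      simp only at this
      exact Multiset.card_eq_zero.1 (by omega)
    refine ⟨_, 0, he.congr fun x hx => hr x (Prog.keeps_of_writesGE hx (by decide)), hm ▸ hc,
      (hr 12 (by decide)).trans h12, by rw [h14, hm], completes_zero hD l, ?_⟩
    rw [h13]
    exact holds_zero _ _ _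
  · rintro σ' ⟨s, Ψ, he, hc, -, -, hcomp, hh⟩
    cases hc with
    | start =>
    obtain ⟨T, rfl, hT, hM⟩ := hcomp.exists_tree hD
    obtain ⟨S, hS⟩ := hh.stored_root
    refine Tri.of_loopFree rfl ⟨?_, T, S, hT, hM, ?_⟩
    · simp [Prog.run, Prog.block, State.reg_setReg]
    · simpa [Prog.run, Prog.block, State.reg_setReg, State.mem_setReg, he.r10] using hS

end Conf

/-! ### Initialization, the complete program and its running time -/

namespace Conf

variable {n k K j : ℕ} {d : List ℕ} {s : Conf} {σ : State} {D : Multiset ℕ}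

/-- The memory with the input and the first `e` powers of `n + 2`, multiplied by the size of a
record. -/
def powMem (n : ℕ) (d : List ℕ) (e p : ℕ) : ℕ :=
  if p < n then d.getD p 0 else if p < n + e then 8 * (n + 2) ^ (p - n) else 0

/-- Write the table of powers. -/
def powProg : Prog :=
  .seq (.block [.const 2 1, .sub 3 1 2, .add 4 0 2, .add 4 4 2, .const 11 8, .const 5 8, .copy 9 0,
    .copy 28 3]) (.loop 28 (.seq (.block [.store 9 5, .add 9 9 2, .copy 27 5])
      (.seq (.mul 5 27 4 26) (.sub 28 28 2))))

/-- The values of the registers and the memory after writing the powers `(n + 2) ^ i`, `i < e`. -/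
structure PowState (n K : ℕ) (d : List ℕ) (e : ℕ) (σ : State) : Prop where
  mem : σ.mem = powMem n d e
  r0 : σ.reg 0 = n
  r2 : σ.reg 2 = 1
  r3 : σ.reg 3 = K
  r4 : σ.reg 4 = n + 2
  r5 : σ.reg 5 = 8 * (n + 2) ^ e
  r9 : σ.reg 9 = n + e
  r11 : σ.reg 11 = 8
  r12 : σ.reg 12 = 0

theorem tri_powProg (hd : d.length = n) (hK : K = k - 1) :
    Tri powProg (input k d) (K * (3 * n + 15) + 10) (PowState n K d K) := by
  refine Tri.mono (T := 9 + (K * ((4 + ((3 * (n + 2) + 3) + 1)) + 1) + 1)) (Q := PowState n K d K) ?_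
    (by rw [show (4 + ((3 * (n + 2) + 3) + 1)) + 1 = 3 * n + 15 by omega]; omega) fun _ h => h
  refine Tri.seq (Tri.of_loopFree (Q := fun σ => PowState n K d 0 σ ∧ σ.reg 28 = K) rfl ?_) ?_
  · refine ⟨⟨?_, ?_, ?_, ?_, ?_, ?_, ?_, ?_, ?_⟩, ?_⟩
    · funext p
      simp only [Prog.run, Prog.block, State.mem_setReg, input, powMem, add_zero]
      by_cases hp : p < n
      · rw [if_pos hp]
      · rw [if_neg hp, if_neg hp, List.getD_eq_default _ _ (by omega)]
    all_goals simp [Prog.run, Prog.block, State.reg_setReg, input, hd, hK]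
  rintro σ₁ ⟨h₁, h28⟩
  refine Tri.mono (Tri.loop (I := fun j σ => ∃ e, e + j = K ∧ PowState n K d e σ ∧ σ.reg 28 = j)
    ?_ ?_ K σ₁ ⟨0, by omega, h₁, h28⟩) le_rfl ?_
  · rintro σ ⟨-, -, -, h⟩
    exact h
  · rintro j σ ⟨e, hj, h, h28⟩
    refine ⟨by omega, ?_⟩
    refine Tri.seq (Tri.of_loopFree (Q := fun σ' => σ' = ((σ.setMem (n + e) (8 * (n + 2) ^ e)).setReg
      9 (n + e + 1)).setReg 27 (8 * (n + 2) ^ e)) rfl ?_) ?_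
    · simp [Prog.run, Prog.block, State.reg_setReg, State.reg_setMem, h.r9, h.r5, h.r2]
    rintro _ rfl
    have hmul := Tri.mul (s := ((σ.setMem (n + e) (8 * (n + 2) ^ e)).setReg
      9 (n + e + 1)).setReg 27 (8 * (n + 2) ^ e)) 5 27 4 26
      (by simp [State.reg_setReg, State.reg_setMem, h.r2]) (by omega) (by omega) (by omega)
      (by omega) (by omega) (by omega)
    simp only [State.reg_setReg, State.reg_setMem, h.r4, reduceIte, Nat.reduceEqDiff,
      State.mem_setReg, State.mem_setMem, h.mem] at hmul
    refine Tri.seq hmul ?_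
    rintro σ₂ ⟨h5, hm, hr⟩
    refine Tri.of_loopFree rfl ⟨e + 1, by omega, ⟨?_, ?_, ?_, ?_, ?_, ?_, ?_, ?_, ?_⟩, ?_⟩
    · simp only [Prog.run, State.mem_setReg, hm]
      funext p
      simp only [Function.update_apply, powMem]
      by_cases hp : p = n + e
      · subst hp
        simp
      · rw [if_neg hp]
        by_cases hp' : p < n + e
        · rw [if_pos hp', if_pos (show p < n + (e + 1) by omega)]
        · rw [if_neg hp', if_neg (show ¬ p < n + (e + 1) by omega)]
    · simp [Prog.run, State.reg_setReg, hr, h.r0]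
    · simp [Prog.run, State.reg_setReg, hr, h.r2]
    · simp [Prog.run, State.reg_setReg, hr, h.r3]
    · simp [Prog.run, State.reg_setReg, hr, h.r4]
    · simp [Prog.run, State.reg_setReg, h5, pow_succ, mul_assoc]
    · simp [Prog.run, State.reg_setReg, hr, add_assoc]
    · simp [Prog.run, State.reg_setReg, hr, h.r11]
    · simp [Prog.run, State.reg_setReg, hr, h.r12]
    · simp [Prog.run, State.reg_setReg, hr, h.r2, h28]
  · rintro σ ⟨e, he, h, -⟩
    obtain rfl : e = K := by omega
    exact h

/-- Compute the dimensions of the table and write the record of the start configuration. -/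
def tableProg : Prog :=
  .seq (.mul 6 5 4 26) (.seq (.add 27 0 2) (.seq (.mul 7 6 27 26) (.seq (.mul 8 3 0 26)
    (.seq (.add 27 8 2) (.seq (.mul 10 7 27 26) (.seq (.mul 13 7 8 26) (.seq (.mul 27 6 0 26)
      (.block [.add 10 9 10, .add 13 13 27, .add 13 13 5, .add 14 9 13, .add 13 13 11, .store 14 2,
        .const 27 3, .add 14 14 27, .store 14 5]))))))))

theorem addr_start (n K : ℕ) : addr n K start =
    n + K + row n K * (n + 1) * (K * n) + row n K * n + 8 * (n + 2) ^ K := by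
  simp [addr, start, levelCode]

theorem table_start (hn : 1 ≤ n) {m : ℕ → ℕ}
    (hm : m = Function.update (Function.update (powMem n d K) (addr n K start) 1)
      (addr n K start + 3) (8 * (n + 2) ^ K)) : Table n K d m := by
  obtain ⟨x, hx⟩ := exists_addr_eq (n := n) (K := K) start
  have hz : ∀ p, n + K ≤ p → p ≠ addr n K start → p ≠ addr n K start + 3 → m p = 0 := by
    intro p h1 h2 h3
    rw [hm, Function.update_of_ne h3, Function.update_of_ne h2, powMem, if_neg (by omega),
      if_neg (by omega)]
  have h0 : m (addr n K start) = 1 := by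
    rw [hm, Function.update_of_ne (by omega), Function.update_self]
  have hlt : ∀ p < n + K, m p = powMem n d K p := fun p hp => by
    rw [hm, Function.update_of_ne (by omega), Function.update_of_ne (by omega)]
  refine ⟨fun p hp => ?_, fun j hj => ?_, fun y hy => ⟨0, start, ?_, ?_⟩, by omega⟩
  · rw [hlt p (by omega), powMem, if_pos hp]
  · rw [hlt _ (by omega), powMem, if_neg (by omega), if_pos (by omega), Nat.add_sub_cancel_left]
  · refine .start ⟨valid_start hn, by rw [h0]; rfl, ?_, ?_, ?_⟩ ?_
    · exact hz _ (by omega) (by omega) (by omega)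
    · exact hz _ (by omega) (by omega) (by omega)
    · rw [hm, Function.update_self]
      simp [start, levelCode]
    · exact hz _ (by omega) (by omega) (by omega)
  · by_contra hne
    exact hy (hz _ (by omega) (Ne.symm hne) (by omega))

theorem tri_tableProg (h : PowState n K d K σ) (hn : 1 ≤ n) :
    Tri tableProg σ (6 * (K * n) + 12 * n + 45) fun σ' =>
      ∃ j ≤ (n + 2) ^ (K + 1) * (n + 1) * (K * n + 1), Swept n K d j σ' := by
  refine Tri.mono (T := (3 * (n + 2) + 3) + (1 + ((3 * (n + 1) + 3) + ((3 * n + 3) + (1 +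
    ((3 * (K * n + 1) + 3) + ((3 * (K * n) + 3) + ((3 * n + 3) + 10)))))))) (Q := fun σ' =>
      ∃ j ≤ (n + 2) ^ (K + 1) * (n + 1) * (K * n + 1), Swept n K d j σ') ?_ (by omega) fun _ h => h
  have M1 := Tri.mul (s := σ) 6 5 4 26 h.r2 (by omega) (by omega) (by omega) (by omega) (by omega)
    (by omega)
  rw [h.r4, h.r5, mul_assoc, ← pow_succ, ← row] at M1
  refine M1.seq ?_
  rintro σ₁ ⟨v1, m1, r1⟩
  refine Tri.seq (Tri.of_loopFree (Q := fun σ' => σ' = σ₁.setReg 27 (n + 1)) rfl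
    (by simp [Prog.run, r1, h.r0, h.r2])) ?_
  rintro _ rfl
  have M2 := Tri.mul (s := σ₁.setReg 27 (n + 1)) 7 6 27 26
    (by simp [State.reg_setReg, r1, h.r2]) (by omega) (by omega) (by omega) (by omega) (by omega)
    (by omega)
  simp only [State.reg_setReg, reduceIte, Nat.reduceEqDiff, v1, State.mem_setReg] at M2
  refine M2.seq ?_
  rintro σ₂ ⟨v2, m2, r2⟩
  have M3 := Tri.mul (s := σ₂) 8 3 0 26 (by simp [r2, r1, h.r2]) (by omega) (by omega) (by omega)
    (by omega) (by omega) (by omega)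
  rw [show σ₂.reg 3 = K by simp [r2, r1, h.r3], show σ₂.reg 0 = n by simp [r2, r1, h.r0]] at M3
  refine M3.seq ?_
  rintro σ₃ ⟨v3, m3, r3⟩
  refine Tri.seq (Tri.of_loopFree (Q := fun σ' => σ' = σ₃.setReg 27 (K * n + 1)) rfl
    (by simp [Prog.run, v3, r3, r2, r1, h.r2])) ?_
  rintro _ rfl
  have M4 := Tri.mul (s := σ₃.setReg 27 (K * n + 1)) 10 7 27 26
    (by simp [State.reg_setReg, r3, r2, r1, h.r2]) (by omega) (by omega) (by omega) (by omega)
    (by omega) (by omega)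
  simp only [State.reg_setReg, reduceIte, Nat.reduceEqDiff, State.mem_setReg] at M4
  rw [r3 7 (by omega) (by omega), v2] at M4
  refine M4.seq ?_
  rintro σ₄ ⟨v4, m4, r4⟩
  have M5 := Tri.mul (s := σ₄) 13 7 8 26 (by simp [r4, r3, r2, r1, h.r2]) (by omega) (by omega)
    (by omega) (by omega) (by omega) (by omega)
  rw [show σ₄.reg 7 = row n K * (n + 1) by simp [r4, r3, v2],
    show σ₄.reg 8 = K * n by simp [r4, v3]] at M5
  refine M5.seq ?_
  rintro σ₅ ⟨v5, m5, r5⟩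
  have M6 := Tri.mul (s := σ₅) 27 6 0 26 (by simp [r5, r4, r3, r2, r1, h.r2]) (by omega) (by omega)
    (by omega) (by omega) (by omega) (by omega)
  rw [show σ₅.reg 6 = row n K by simp [r5, r4, r3, r2, v1],
    show σ₅.reg 0 = n by simp [r5, r4, r3, r2, r1, h.r0]] at M6
  refine M6.seq ?_
  rintro σ₆ ⟨v6, m6, r6⟩
  have hmem : σ₆.mem = powMem n d K := by rw [m6, m5, m4, m3, m2, m1, h.mem]
  have a0 : σ₆.reg 0 = n := by simp [r6, r5, r4, r3, r2, r1, h.r0]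
  have a2 : σ₆.reg 2 = 1 := by simp [r6, r5, r4, r3, r2, r1, h.r2]
  have a3 : σ₆.reg 3 = K := by simp [r6, r5, r4, r3, r2, r1, h.r3]
  have a4 : σ₆.reg 4 = n + 2 := by simp [r6, r5, r4, r3, r2, r1, h.r4]
  have a5 : σ₆.reg 5 = 8 * (n + 2) ^ K := by simp [r6, r5, r4, r3, r2, r1, h.r5]
  have a6 : σ₆.reg 6 = row n K := by simp [r6, r5, r4, r3, r2, v1]
  have a7 : σ₆.reg 7 = row n K * (n + 1) := by simp [r6, r5, r4, r3, v2]
  have a8 : σ₆.reg 8 = K * n := by simp [r6, r5, r4, v3]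
  have a9 : σ₆.reg 9 = n + K := by simp [r6, r5, r4, r3, r2, r1, h.r9]
  have a10 : σ₆.reg 10 = row n K * (n + 1) * (K * n + 1) := by simp [r6, r5, v4]
  have a11 : σ₆.reg 11 = 8 := by simp [r6, r5, r4, r3, r2, r1, h.r11]
  have a12 : σ₆.reg 12 = 0 := by simp [r6, r5, r4, r3, r2, r1, h.r12]
  have a13 : σ₆.reg 13 = row n K * (n + 1) * (K * n) := by simp [r6, v5]
  obtain ⟨x, hx⟩ := exists_addr_eq (n := n) (K := K) start
  have hend : tableEnd n K = n + K + 8 * ((n + 2) ^ (K + 1) * (n + 1) * (K * n + 1)) := by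
    rw [tableEnd, row]
    ring
  have hlt := (valid_start (K := K) hn).addr_lt
  have hA := addr_start n K
  -- The sweep begins just above the start record, the `x`-th slot. No chain reaches higher, so
  -- nothing counts as swept yet.
  refine Tri.of_loopFree rfl ⟨x + 1, by omega, ⟨?_, ?_, ?_, ?_, ?_, ?_, ?_, ?_, ?_, ?_, ?_⟩, ?_, ?_,
    fun i s hc hle => ?_, fun h => absurd ?_ h⟩
  · simp [Prog.run, Prog.block, State.reg_setReg, State.reg_setMem, a0]
  · simp [Prog.run, Prog.block, State.reg_setReg, State.reg_setMem, a2]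
  · simp [Prog.run, Prog.block, State.reg_setReg, State.reg_setMem, a3]
  · simp [Prog.run, Prog.block, State.reg_setReg, State.reg_setMem, a4]
  · simp [Prog.run, Prog.block, State.reg_setReg, State.reg_setMem, a5]
  · simp [Prog.run, Prog.block, State.reg_setReg, State.reg_setMem, a6]
  · simp [Prog.run, Prog.block, State.reg_setReg, State.reg_setMem, a7]
  · simp [Prog.run, Prog.block, State.reg_setReg, State.reg_setMem, a8]
  · simp [Prog.run, Prog.block, State.reg_setReg, State.reg_setMem, a9]
  · simp [Prog.run, Prog.block, State.reg_setReg, State.reg_setMem, a9, a10, tableEnd]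
  · simp [Prog.run, Prog.block, State.reg_setReg, State.reg_setMem, a11]
  · refine table_start hn ?_
    simp [Prog.run, Prog.block, State.reg_setReg, State.reg_setMem, State.mem_setReg,
      State.mem_setMem, hmem, a2, a5, a9, a13, v6, hA, add_assoc]
  · simp only [Prog.run, Prog.block, State.reg_setReg, State.reg_setMem, a5, a11, a13, v6,
      reduceIte, Nat.reduceEqDiff]
    omega
  · have := hc.add_le
    omega
  · simp [Prog.run, Prog.block, State.reg_setReg, State.reg_setMem, a12]

/-- The complete program. -/
def searchProg : Prog :=
  .seq powProg (.seq tableProg (.seq sweepProg (.branch 12 buildProg (.const 0 0))))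

theorem tri_searchProg (hd : d.length = n) (hn : 1 ≤ n) (hK : K = k - 1) :
    Tri searchProg (input k d) ((n + 2) ^ (K + 1) * (n + 1) * (K * n + 1) *
      (n * (1000 * (K + 1)))) fun σ =>
        (σ.reg 0 = 1 ∧ ∃ T S, T.IsL k ∧ T.Meets d ∧ Stored σ.mem T (σ.reg 1) S) ∨
        (σ.reg 0 = 0 ∧ ¬ Realizable k d) := by
  set N := (n + 2) ^ (K + 1) * (n + 1) * (K * n + 1) with hN
  have hN1 : 1 ≤ N := Nat.one_le_iff_ne_zero.2 (by positivity)
  refine Tri.mono (T := (K * (3 * n + 15) + 10) + ((6 * (K * n) + 12 * n + 45) +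
    ((N * (n * 7 + K * 28 + 58) + 1) + (1 + (8 * N * 54 + 11))))) (Q := fun σ =>
        (σ.reg 0 = 1 ∧ ∃ T S, T.IsL k ∧ T.Meets d ∧ Stored σ.mem T (σ.reg 1) S) ∨
        (σ.reg 0 = 0 ∧ ¬ Realizable k d)) ?_ ?_ fun _ h => h
  · refine (tri_powProg hd hK).seq fun σ₁ h₁ => (tri_tableProg h₁ hn).seq ?_
    rintro σ₂ ⟨j, hj, h₂⟩
    refine Tri.seq ((tri_sweepProg h₂ hd hn).mono ?_ fun _ h => h) ?_
    · gcongr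
    intro σ₃ h₃
    refine Tri.branch (fun h0 => ?_) fun h0 => ?_
    · obtain ⟨i, s, hc, hs, h12⟩ := h₃.fin h0
      refine (tri_buildProg h₃.env hc hs h12 hK (by simpa using hd) hn).mono ?_ fun _ h => .inl h
      -- The chain is at most as long as the table has cells, that is `8 * N`, which bounds the
      -- passes of the tree construction.
      have h1 := hc.add_le
      have h2 := (valid_start (K := K) hn).addr_lt
      have h3 : tableEnd n K = n + K + 8 * N := by
        rw [tableEnd, row, hN]
        ring
      have h4 : n + K ≤ addr n K s := by simp only [addr]; omega
      omega
    · refine (Tri.of_loopFree rfl (Q := fun σ => σ.reg 0 = 0) ?_).mono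
        (by simp only [Prog.cost]; omega) fun σ h => .inr ⟨h, fun hreal => ?_⟩
      · simp [Prog.run, State.reg_setReg]
      · obtain ⟨s, hs, hdone⟩ := exists_reachable_of_realizable hreal
        rw [Multiset.coe_card, hd, ← hK] at hs
        rw [Multiset.coe_card, hd] at hdone
        obtain ⟨i, hc⟩ := h₃.chain_of_reachable hn hs
        exact (h₃.closed i s hc (by simp only [addr]; omega)).1 hdone h0
  · have e1 : K * n ≤ N * n * K := by nlinarith [Nat.zero_le (K * n)]
    have e2 : K ≤ N * n * K := Nat.le_mul_of_pos_left _ (by positivity)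
    have e3 : n ≤ N * n := Nat.le_mul_of_pos_left _ (by omega)
    have e4 : N ≤ N * n := Nat.le_mul_of_pos_right _ (by omega)
    have e5 : N * K ≤ N * n * K := Nat.mul_le_mul_right _ e4
    have e6 : 1 ≤ N * n := hn.trans e3
    have e7 : N * (n * (1000 * (K + 1))) = 1000 * (N * n * K) + 1000 * (N * n) := by ring
    have e8 : N * (n * 7 + K * 28 + 58) = 7 * (N * n) + 28 * (N * K) + 58 * N := by ring
    have e9 : K * (3 * n + 15) = 3 * (K * n) + 15 * K := by ring
    rw [e7, e8, e9]
    omega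

/-- The exponents are `K + 1` for the codes and one each for finished leaves, levels and the work
per record. -/
theorem table_size_le (hn : 1 ≤ n) (hK : K = k - 1) :
    (n + 2) ^ (K + 1) * (n + 1) * (K * n + 1) * n ≤
      6 * (K + 1) * 3 ^ (K + 1) * n ^ (k + 3) := by
  have h3 : (n + 2) ^ (K + 1) ≤ 3 ^ (K + 1) * n ^ (K + 1) := by
    rw [← mul_pow]
    exact Nat.pow_le_pow_left (by omega) _
  cases k with
  | zero =>
    -- Here `k - 1` truncates and `K + 4` would exceed `k + 3`, but the number of levels is `1`,
    -- which saves a factor `n`.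
    obtain rfl : K = 0 := hK
    have : (n + 2) * (n + 1) ≤ (3 * n) * (2 * n) := Nat.mul_le_mul (by omega) (by omega)
    calc (n + 2) ^ (0 + 1) * (n + 1) * (0 * n + 1) * n = (n + 2) * (n + 1) * n := by ring
      _ ≤ (3 * n) * (2 * n) * n := Nat.mul_le_mul_right _ this
      _ = 6 * n ^ 3 := by ring
      _ ≤ 18 * n ^ 3 := Nat.mul_le_mul_right _ (by omega)
      _ = 6 * (0 + 1) * 3 ^ (0 + 1) * n ^ (0 + 3) := by ring
  | succ k =>
    obtain rfl : K = k := by omega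
    have h1 : n + 1 ≤ 2 * n := by omega
    have h2 : K * n + 1 ≤ (K + 1) * n := by nlinarith
    calc (n + 2) ^ (K + 1) * (n + 1) * (K * n + 1) * n
        ≤ (3 ^ (K + 1) * n ^ (K + 1)) * (2 * n) * ((K + 1) * n) * n := by gcongr
      _ = 2 * ((K + 1) * 3 ^ (K + 1) * n ^ (K + 1 + 3)) := by ring
      _ ≤ 6 * ((K + 1) * 3 ^ (K + 1) * n ^ (K + 1 + 3)) := Nat.mul_le_mul_right _ (by omega)
      _ = _ := by ring

end Conf

theorem mainTheorem1 :
    ∃ P : RAM.Prog, ∀ k : ℕ, ∃ C : ℕ, ∀ d : List ℕ, d ≠ [] →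
      ∃ (t : ℕ) (s : RAM.State), RAM.Exec P (RAM.input k d) t s ∧
        t ≤ C * d.length ^ (k + 3) ∧
        (Realizable k (d : Multiset ℕ) → s.reg 0 = 1 ∧
          ∃ (T : LTree) (S : Finset ℕ),
            T.IsL k ∧ T.Meets (d : Multiset ℕ) ∧ RAM.Stored s.mem T (s.reg 1) S) ∧
        (¬ Realizable k (d : Multiset ℕ) → s.reg 0 = 0) := by
  refine ⟨Conf.searchProg, fun k => ⟨6 * (k - 1 + 1) * 3 ^ (k - 1 + 1) * (1000 * (k - 1 + 1)),
    fun d hd => ?_⟩⟩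
  have hn : 1 ≤ d.length := List.length_pos_iff.2 hd
  obtain ⟨t, s, h₁, h₂, h₃⟩ := Conf.tri_searchProg (k := k) rfl hn rfl
  refine ⟨t, s, h₁, h₂.trans ?_, ?_, ?_⟩
  · have := Nat.mul_le_mul_right (1000 * (k - 1 + 1)) (Conf.table_size_le (k := k) hn rfl)
    rw [mul_assoc _ d.length] at this
    exact this.trans (le_of_eq (by ring))
  · intro hr
    rcases h₃ with h | h
    · exact h
    · exact absurd hr h.2
  · intro hr
    rcases h₃ with ⟨-, T, -, hT, hM, -⟩ | h
    · exact absurd ⟨T, hT, hM⟩ hr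
    · exact h.1
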